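/- Let $X,Y$ be nonempty compact Hausdorff spaces. Consider pairs $(\rho,\sigma)$ of continuous maps $\rho:X\to\mathcal B(\mathcal H)_{>0}$, $\sigma:Y\to\mathcal B(\mathcal H)_{>0}$ into the positive definite operators on a finite-dimensional complex Hilbert space $\mathcal H$ (possibly of dimension $0$), where $(\rho,\sigma)$ and $(\rho',\sigma')$ are identified if $U\rho(x)U^*=\rho'(x)$ and $U\sigma(y)U^*=\sigma'(y)$ for all $x\in X$, $y\in Y$ and some unitary $U:\mathcal H\to\mathcal H'$. The equivalence classes form a commutative semiring $\mathcal S_{X,Y}$ under pointwise direct sum and tensor product, preordered by relative submajorization: $(\rho,\sigma)\succcurlyeq(\rho',\sigma')$ if there is a completely positive trace-nonincreasing map $T:\mathcal B(\mathcal H)\to\mathcal B(\mathcal H')$ with $T(\rho(x))\ge\rho'(x)$ for all $x\in X$ and $T(\sigma(y))\le\sigma'(y)$ for all $y\in Y$. The subsemiring $\mathcal S^{\mathrm c}_{X,Y}$ of classical families is the one generated by the one-dimensional elements, with the induced preorder; its elements are the pairs $(\bigoplus_{i=1}^d p_i,\bigoplus_{i=1}^d q_i)$ with $d\in\mathbb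 N$ and strictly positive $p_i\in C(X)$, $q_i\in C(Y)$. Let $\mathbb{TR}$ be the tropical real semiring, i.e. the set $\mathbb R_{\ge0}$ with addition $\max$, the usual multiplication and the usual order. Let $u=(2,1)\in\mathcal S^{\mathrm c}_{X,Y}$ be the one-dimensional pair of constant functions $2$ and $1$. The 1-test spectrum $\mathrm{TSper}_1(\mathcal S^{\mathrm c}_{X,Y})$ is the (disjoint) union of the set of monotone semiring homomorphisms $f:\mathcal S^{\mathrm c}_{X,Y}\to\mathbb R_{\ge0}$ and the set of monotone semiring homomorphisms $f:\mathcal S^{\mathrm c}_{X,Y}\to\mathbb{TR}$ with $f(u)=2$. Then $\mathrm{TSper}_1(\mathcal S^{\mathrm c}_{X,Y})$ consists exactly of the following functions: (i) (real points) $$f_{\alpha,x,\gamma}\Bigl(\bigoplus_{i=1}^d p_i,\bigoplus_{i=1}^d q_i\Bigr)=\sum_{i=1}^d p_i(x)^\alpha\exp\Bigl[(1-\alpha)\int_Y\ln q_i\,\mathrm d\gamma\Bigr],$$ where $\alpha\ge1$, $x\in X$ and $\gamma$ is a probability measure on $Y$; (ii) (tropical points) $$f_{x,\gamma}\Bigl(\bigoplus_{i=1}^d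 p_i,\bigoplus_{i=1}^d q_i\Bigr)=\max_{1\le i\le d}\, p_i(x)\exp\Bigl[-\int_Y\ln q_i\,\mathrm d\gamma\Bigr],$$ where $x\in X$ and $\gamma$ is a probability measure on $Y$ (the empty maximum, for $d=0$, being $0$). That is: for every $\alpha\ge1$, $x\in X$ and Borel probability measure $\gamma$ on $Y$, the formula (i) gives exactly one well-defined element of the real part of the spectrum, and (ii) exactly one element of the tropical part; and conversely every element of the real part is of the form (i), and every element of the tropical part is of the form (ii), where moreover $\gamma$ can be taken to be a Radon (regular Borel) probability measure. -/

import Mathlib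

open scoped NNReal

noncomputable section

namespace Families

open Matrix
open scoped Matrix.Norms.L2Operator MatrixOrder ComplexOrder CStarAlgebra Kronecker

universe u v

/-- A pair `(ρ, σ)` of continuous families `ρ : X → B(ℂ^ι)_{>0}`, `σ : Y → B(ℂ^ι)_{>0}` of positive
definite operators on the Hilbert space `ℂ^ι` (which may be zero-dimensional). -/
structure FamilyPair (X : Type u) (Y : Type v) [TopologicalSpace X] [TopologicalSpace Y]
    (ι : Type) [Fintype ι] [DecidableEq ι] where
  rho : C(X, Matrix ι ι ℂ)
  sigma : C(Y, Matrix ι ι ℂ)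
  rho_posDef : ∀ x, (rho x).PosDef
  sigma_posDef : ∀ y, (sigma y).PosDef

variable {X : Type u} {Y : Type v} [TopologicalSpace X] [TopologicalSpace Y]
variable {ι κ μ ι' κ' : Type} [Fintype ι] [DecidableEq ι] [Fintype κ] [DecidableEq κ]
  [Fintype μ] [DecidableEq μ] [Fintype ι'] [DecidableEq ι'] [Fintype κ'] [DecidableEq κ']

set_option linter.unusedSectionVars false in
theorem posDef_fromBlocks {A : Matrix ι ι ℂ} {B : Matrix κ κ ℂ} (hA : A.PosDef) (hB : B.PosDef) :
    (fromBlocks A 0 0 B).PosDef := by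
  refine .of_dotProduct_mulVec_pos ?_ fun v hv => ?_
  · exact IsHermitian.fromBlocks hA.1 (by simp) hB.1
  · have key : star v ⬝ᵥ (fromBlocks A 0 0 B *ᵥ v) =
        star (v ∘ Sum.inl) ⬝ᵥ (A *ᵥ (v ∘ Sum.inl)) +
          star (v ∘ Sum.inr) ⬝ᵥ (B *ᵥ (v ∘ Sum.inr)) := by
      rw [fromBlocks_mulVec]
      simp [dotProduct, Fintype.sum_sum_type]
    rw [key]
    by_cases h1 : v ∘ Sum.inl = 0
    · have h2 : v ∘ Sum.inr ≠ 0 := by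
        intro h2
        apply hv
        funext i
        rcases i with i | i
        · exact congrFun h1 i
        · exact congrFun h2 i
      exact add_pos_of_nonneg_of_pos (hA.posSemidef.dotProduct_mulVec_nonneg _)
        (hB.dotProduct_mulVec_pos h2)
    · exact add_pos_of_pos_of_nonneg (hA.dotProduct_mulVec_pos h1)
        (hB.posSemidef.dotProduct_mulVec_nonneg _)

namespace FamilyPair

/-- Pointwise direct sum of two pairs of families. -/
def dsum (A : FamilyPair X Y ι) (B : FamilyPair X Y κ) : FamilyPair X Y (ι ⊕ κ) where
  rho := ⟨fun x => fromBlocks (A.rho x) 0 0 (B.rho x), by fun_prop⟩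
  sigma := ⟨fun y => fromBlocks (A.sigma y) 0 0 (B.sigma y), by fun_prop⟩
  rho_posDef x := posDef_fromBlocks (A.rho_posDef x) (B.rho_posDef x)
  sigma_posDef y := posDef_fromBlocks (A.sigma_posDef y) (B.sigma_posDef y)

/-- Pointwise tensor product of two pairs of families. -/
def tens (A : FamilyPair X Y ι) (B : FamilyPair X Y κ) : FamilyPair X Y (ι × κ) where
  rho := ⟨fun x => A.rho x ⊗ₖ B.rho x, by
    refine continuous_matrix fun i j => ?_
    exact ((A.rho.continuous.matrix_elem i.1 j.1).mul (B.rho.continuous.matrix_elem i.2 j.2))⟩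
  sigma := ⟨fun y => A.sigma y ⊗ₖ B.sigma y, by
    refine continuous_matrix fun i j => ?_
    exact ((A.sigma.continuous.matrix_elem i.1 j.1).mul (B.sigma.continuous.matrix_elem i.2 j.2))⟩
  rho_posDef x := (A.rho_posDef x).kronecker (B.rho_posDef x)
  sigma_posDef y := (A.sigma_posDef y).kronecker (B.sigma_posDef y)

/-- The same pair of families with the orthonormal basis relabelled. -/
def reindex (e : ι ≃ κ) (A : FamilyPair X Y ι) : FamilyPair X Y κ where
  rho := ⟨fun x => (A.rho x).submatrix e.symm e.symm, A.rho.continuous.matrix_submatrix _ _⟩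
  sigma := ⟨fun y => (A.sigma y).submatrix e.symm e.symm, A.sigma.continuous.matrix_submatrix _ _⟩
  rho_posDef x := (A.rho_posDef x).submatrix e.symm.injective
  sigma_posDef y := (A.sigma_posDef y).submatrix e.symm.injective

/-- The one-dimensional pair of families given by a strictly positive continuous function on `X`
and a strictly positive continuous function on `Y`. -/
def ofFun (p : C(X, Set.Ioi (0 : ℝ))) (q : C(Y, Set.Ioi (0 : ℝ))) : FamilyPair X Y Unit where
  rho := ⟨fun x => diagonal fun _ => (((p x : ℝ)) : ℂ), by fun_prop⟩
  sigma := ⟨fun y => diagonal fun _ => (((q y : ℝ)) : ℂ), by fun_prop⟩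
  rho_posDef x := by
    exact posDef_diagonal_iff.2 fun _ => Complex.zero_lt_real.2 (p x).2
  sigma_posDef y := by
    exact posDef_diagonal_iff.2 fun _ => Complex.zero_lt_real.2 (q y).2

/-- The unit: constant families with value the identity of `ℂ`. -/
def unit : FamilyPair X Y Unit where
  rho := ContinuousMap.const X 1
  sigma := ContinuousMap.const Y 1
  rho_posDef _ := PosDef.one
  sigma_posDef _ := PosDef.one

/-- The unique pair of families on the zero-dimensional Hilbert space. -/
def empty : FamilyPair X Y Empty where
  rho := ContinuousMap.const X 1
  sigma := ContinuousMap.const Y 1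
  rho_posDef _ := PosDef.one
  sigma_posDef _ := PosDef.one

/-- Unitary equivalence: some unitary `U : ℂ^ι → ℂ^κ` satisfies `U ρ(x) U* = ρ'(x)` and
`U σ(y) U* = σ'(y)` for all `x` and `y`. -/
def UEquiv (A : FamilyPair X Y ι) (B : FamilyPair X Y κ) : Prop :=
  ∃ U : Matrix κ ι ℂ, Uᴴ * U = 1 ∧ U * Uᴴ = 1 ∧
    (∀ x, U * A.rho x * Uᴴ = B.rho x) ∧ (∀ y, U * A.sigma y * Uᴴ = B.sigma y)

/-- Relative submajorization: some completely positive trace-nonincreasing map `T` satisfies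
`T(ρ) ≥ ρ'` and `T(σ) ≤ σ'` pointwise, in the semidefinite order. -/
def Submajorizes (A : FamilyPair X Y ι) (B : FamilyPair X Y κ) : Prop :=
  ∃ T : Matrix ι ι ℂ →CP Matrix κ κ ℂ,
    (∀ M : Matrix ι ι ℂ, 0 ≤ M → (T M).trace ≤ M.trace) ∧
    (∀ x, B.rho x ≤ T (A.rho x)) ∧ (∀ y, T (A.sigma y) ≤ B.sigma y)

theorem UEquiv.refl (A : FamilyPair X Y ι) : UEquiv A A :=
  ⟨1, by simp, by simp, by simp, by simp⟩

theorem UEquiv.symm {A : FamilyPair X Y ι} {B : FamilyPair X Y κ} (h : UEquiv A B) :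
    UEquiv B A := by
  obtain ⟨U, h1, h2, h3, h4⟩ := h
  refine ⟨Uᴴ, by simpa using h2, by simpa using h1, fun x => ?_, fun y => ?_⟩
  · rw [← h3, conjTranspose_conjTranspose]
    calc Uᴴ * (U * A.rho x * Uᴴ) * U = (Uᴴ * U) * A.rho x * (Uᴴ * U) := by
          simp only [Matrix.mul_assoc]
      _ = A.rho x := by simp [h1]
  · rw [← h4, conjTranspose_conjTranspose]
    calc Uᴴ * (U * A.sigma y * Uᴴ) * U = (Uᴴ * U) * A.sigma y * (Uᴴ * U) := by
          simp only [Matrix.mul_assoc]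
      _ = A.sigma y := by simp [h1]

theorem UEquiv.trans {A : FamilyPair X Y ι} {B : FamilyPair X Y κ} {C : FamilyPair X Y μ}
    (h : UEquiv A B) (h' : UEquiv B C) : UEquiv A C := by
  obtain ⟨U, h1, h2, h3, h4⟩ := h
  obtain ⟨V, k1, k2, k3, k4⟩ := h'
  refine ⟨V * U, ?_, ?_, fun x => ?_, fun y => ?_⟩
  · calc (V * U)ᴴ * (V * U) = Uᴴ * (Vᴴ * V) * U := by
          simp only [conjTranspose_mul, Matrix.mul_assoc]
      _ = 1 := by simp [h1, k1]
  · calc (V * U) * (V * U)ᴴ = V * (U * Uᴴ) * Vᴴ := by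
          simp only [conjTranspose_mul, Matrix.mul_assoc]
      _ = 1 := by simp [h2, k2]
  · rw [← k3, ← h3]; simp only [conjTranspose_mul, Matrix.mul_assoc]
  · rw [← k4, ← h4]; simp only [conjTranspose_mul, Matrix.mul_assoc]

/-- Relabelling a basis is a unitary equivalence. -/
theorem UEquiv.of_equiv {A : FamilyPair X Y ι} {B : FamilyPair X Y κ} (e : κ ≃ ι)
    (h1 : ∀ x i j, A.rho x (e i) (e j) = B.rho x i j)
    (h2 : ∀ y i j, A.sigma y (e i) (e j) = B.sigma y i j) : UEquiv A B := by
  have key : ∀ M : Matrix ι ι ℂ, (1 : Matrix ι ι ℂ).submatrix e id * M *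
      ((1 : Matrix ι ι ℂ).submatrix e id)ᴴ = M.submatrix e e := by
    intro M
    have a1 : (1 : Matrix ι ι ℂ).submatrix e id * M = M.submatrix e id := by
      ext i j
      simp [Matrix.mul_apply, Matrix.one_apply]
    rw [a1]
    ext i j
    simp [Matrix.mul_apply, Matrix.one_apply]
  refine ⟨(1 : Matrix ι ι ℂ).submatrix e id, ?_, ?_, fun x => ?_, fun y => ?_⟩
  · ext i j
    simp only [Matrix.mul_apply, conjTranspose_apply, submatrix_apply, id, Matrix.one_apply]
    rw [Fintype.sum_equiv e _ (fun k => star (if k = i then (1 : ℂ) else 0) *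
      (if k = j then (1 : ℂ) else 0)) (fun _ => rfl)]
    simp [eq_comm]
  · have := key 1
    rw [Matrix.mul_one] at this
    rw [this]
    ext i j
    simp [Matrix.one_apply]
  · rw [key]; ext i j; exact h1 x i j
  · rw [key]; ext i j; exact h2 y i j

theorem UEquiv.reindex (e : ι ≃ κ) (A : FamilyPair X Y ι) : UEquiv A (A.reindex e) :=
  UEquiv.of_equiv e.symm (fun _ _ _ => rfl) (fun _ _ _ => rfl)

theorem UEquiv.dsum {A : FamilyPair X Y ι} {A' : FamilyPair X Y ι'} {B : FamilyPair X Y κ}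
    {B' : FamilyPair X Y κ'} (h : UEquiv A A') (h' : UEquiv B B') :
    UEquiv (A.dsum B) (A'.dsum B') := by
  obtain ⟨U, h1, h2, h3, h4⟩ := h
  obtain ⟨V, k1, k2, k3, k4⟩ := h'
  refine ⟨fromBlocks U 0 0 V, ?_, ?_, fun x => ?_, fun y => ?_⟩
  · simp [fromBlocks_conjTranspose, fromBlocks_multiply, h1, k1]
  · simp [fromBlocks_conjTranspose, fromBlocks_multiply, h2, k2]
  · simp [FamilyPair.dsum, fromBlocks_conjTranspose, fromBlocks_multiply, h3, k3]
  · simp [FamilyPair.dsum, fromBlocks_conjTranspose, fromBlocks_multiply, h4, k4]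

theorem UEquiv.tens {A : FamilyPair X Y ι} {A' : FamilyPair X Y ι'} {B : FamilyPair X Y κ}
    {B' : FamilyPair X Y κ'} (h : UEquiv A A') (h' : UEquiv B B') :
    UEquiv (A.tens B) (A'.tens B') := by
  obtain ⟨U, h1, h2, h3, h4⟩ := h
  obtain ⟨V, k1, k2, k3, k4⟩ := h'
  refine ⟨U ⊗ₖ V, ?_, ?_, fun x => ?_, fun y => ?_⟩
  · rw [conjTranspose_kronecker, ← mul_kronecker_mul, h1, k1, one_kronecker_one]
  · rw [conjTranspose_kronecker, ← mul_kronecker_mul, h2, k2, one_kronecker_one]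
  · simp only [FamilyPair.tens, ContinuousMap.coe_mk]
    rw [conjTranspose_kronecker, ← mul_kronecker_mul, ← mul_kronecker_mul, h3, k3]
  · simp only [FamilyPair.tens, ContinuousMap.coe_mk]
    rw [conjTranspose_kronecker, ← mul_kronecker_mul, ← mul_kronecker_mul, h4, k4]

theorem UEquiv.submajorizes {A : FamilyPair X Y ι} {B : FamilyPair X Y κ} (h : UEquiv A B) :
    Submajorizes A B := by
  obtain ⟨U, h1, h2, h3, h4⟩ := h
  let φ : Matrix ι ι ℂ →⋆ₙₐ[ℂ] Matrix κ κ ℂ :=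
    { toFun := fun M => U * M * Uᴴ
      map_smul' := fun c M => by simp
      map_zero' := by simp
      map_add' := fun M N => by simp [Matrix.mul_add, Matrix.add_mul]
      map_mul' := fun M N => by
        calc U * (M * N) * Uᴴ = U * (M * ((Uᴴ * U) * (N * Uᴴ))) := by
              simp only [h1, Matrix.one_mul, Matrix.mul_assoc]
          _ = U * M * Uᴴ * (U * N * Uᴴ) := by simp only [Matrix.mul_assoc]
      map_star' := fun M => by
        simp [star_eq_conjTranspose, conjTranspose_mul, Matrix.mul_assoc] }
  have hφ : ∀ M, φ M = U * M * Uᴴ := fun _ => rfl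
  refine ⟨CompletelyPositiveMapClass.toCompletelyPositiveLinearMap φ, fun M _ => ?_,
    fun x => ?_, fun y => ?_⟩
  · change (φ M).trace ≤ _
    rw [hφ, Matrix.trace_mul_comm, ← Matrix.mul_assoc, h1, Matrix.one_mul]
  · change _ ≤ φ _
    rw [hφ, h3]
  · change φ _ ≤ _
    rw [hφ, h4]

theorem Submajorizes.trans {A : FamilyPair X Y ι} {B : FamilyPair X Y κ} {C : FamilyPair X Y μ}
    (h : Submajorizes A B) (h' : Submajorizes B C) : Submajorizes A C := by
  obtain ⟨T, h1, h2, h3⟩ := h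
  obtain ⟨S, k1, k2, k3⟩ := h'
  refine ⟨⟨(S.toLinearMap).comp T.toLinearMap, fun k M hM => ?_⟩, fun M hM => ?_, fun x => ?_,
    fun y => ?_⟩
  · exact S.map_cstarMatrix_nonneg' k _ (T.map_cstarMatrix_nonneg' k M hM)
  · exact (k1 (T M) (map_nonneg T hM)).trans (h1 M hM)
  · exact (k2 x).trans (OrderHomClass.mono S (h2 x))
  · exact (OrderHomClass.mono S (h3 y)).trans (k3 y)

end FamilyPair

open FamilyPair

variable (X Y) in
/-- Unitary equivalence on pairs of families over `ℂ^n`, `n ∈ ℕ`. -/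
def familySetoid : Setoid (Σ n : ℕ, FamilyPair X Y (Fin n)) where
  r A B := UEquiv A.2 B.2
  iseqv := ⟨fun A => UEquiv.refl A.2, fun h => h.symm, fun h h' => h.trans h'⟩

variable (X Y) in
/-- The semiring of unitary equivalence classes of pairs of families of positive definite operators
on finite-dimensional Hilbert spaces (every such Hilbert space is unitarily equivalent to some
`ℂ^n`). -/
def FamilySemiring : Type (max u v) := Quotient (familySetoid X Y)

namespace FamilySemiring

/-- The class of a pair of families. -/
def mk (A : FamilyPair X Y ι) : FamilySemiring X Y :=
  Quotient.mk (familySetoid X Y) ⟨Fintype.card ι, A.reindex (Fintype.equivFin ι)⟩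

theorem mk_eq_mk {A : FamilyPair X Y ι} {B : FamilyPair X Y κ} : mk A = mk B ↔ UEquiv A B := by
  refine ⟨fun h => ?_, fun h => ?_⟩
  · have h' : UEquiv (A.reindex (Fintype.equivFin ι)) (B.reindex (Fintype.equivFin κ)) :=
      Quotient.exact h
    exact ((UEquiv.reindex _ A).trans h').trans (UEquiv.reindex _ B).symm
  · exact Quotient.sound (s := familySetoid X Y)
      (((UEquiv.reindex _ A).symm.trans h).trans (UEquiv.reindex _ B))

theorem quotient_mk_eq (A : Σ n : ℕ, FamilyPair X Y (Fin n)) :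
    Quotient.mk (familySetoid X Y) A = mk A.2 :=
  Quotient.sound (s := familySetoid X Y) (UEquiv.reindex _ A.2)

theorem exists_rep (a : FamilySemiring X Y) : ∃ (n : ℕ) (A : FamilyPair X Y (Fin n)), mk A = a := by
  induction a using Quotient.ind with
  | _ A => exact ⟨A.1, A.2, (quotient_mk_eq A).symm⟩

/-- Addition is the direct sum. -/
instance : Add (FamilySemiring X Y) where
  add := Quotient.lift₂ (fun A B => mk (A.2.dsum B.2))
    (fun _ _ _ _ h h' => mk_eq_mk.2 (UEquiv.dsum h h'))

/-- Multiplication is the tensor product. -/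
instance : Mul (FamilySemiring X Y) where
  mul := Quotient.lift₂ (fun A B => mk (A.2.tens B.2))
    (fun _ _ _ _ h h' => mk_eq_mk.2 (UEquiv.tens h h'))

instance : Zero (FamilySemiring X Y) := ⟨mk FamilyPair.empty⟩

instance : One (FamilySemiring X Y) := ⟨mk FamilyPair.unit⟩

theorem mk_add_mk (A : FamilyPair X Y ι) (B : FamilyPair X Y κ) :
    mk A + mk B = mk (A.dsum B) :=
  mk_eq_mk.2 (UEquiv.dsum (UEquiv.reindex _ A).symm (UEquiv.reindex _ B).symm)

theorem mk_mul_mk (A : FamilyPair X Y ι) (B : FamilyPair X Y κ) :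
    mk A * mk B = mk (A.tens B) :=
  mk_eq_mk.2 (UEquiv.tens (UEquiv.reindex _ A).symm (UEquiv.reindex _ B).symm)

theorem zero_def : (0 : FamilySemiring X Y) = mk FamilyPair.empty := rfl

theorem one_def : (1 : FamilySemiring X Y) = mk FamilyPair.unit := rfl

protected theorem add_comm (a b : FamilySemiring X Y) : a + b = b + a := by
  obtain ⟨n, A, rfl⟩ := exists_rep a
  obtain ⟨m, B, rfl⟩ := exists_rep b
  rw [mk_add_mk, mk_add_mk, mk_eq_mk]
  refine UEquiv.of_equiv (Equiv.sumComm _ _) ?_ ?_ <;> rintro x (i | i) (j | j) <;> rfl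

protected theorem add_assoc (a b c : FamilySemiring X Y) : a + b + c = a + (b + c) := by
  obtain ⟨n, A, rfl⟩ := exists_rep a
  obtain ⟨m, B, rfl⟩ := exists_rep b
  obtain ⟨l, C, rfl⟩ := exists_rep c
  rw [mk_add_mk, mk_add_mk, mk_add_mk, mk_add_mk, mk_eq_mk]
  refine UEquiv.of_equiv (Equiv.sumAssoc _ _ _).symm ?_ ?_ <;>
    rintro x (i | i | i) (j | j | j) <;> rfl

protected theorem zero_add (a : FamilySemiring X Y) : 0 + a = a := by
  obtain ⟨n, A, rfl⟩ := exists_rep a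
  rw [zero_def, mk_add_mk, mk_eq_mk]
  exact UEquiv.of_equiv (Equiv.emptySum _ _).symm (fun _ _ _ => rfl) (fun _ _ _ => rfl)

protected theorem mul_comm (a b : FamilySemiring X Y) : a * b = b * a := by
  obtain ⟨n, A, rfl⟩ := exists_rep a
  obtain ⟨m, B, rfl⟩ := exists_rep b
  rw [mk_mul_mk, mk_mul_mk, mk_eq_mk]
  exact UEquiv.of_equiv (Equiv.prodComm _ _) (fun _ _ _ => mul_comm _ _)
    (fun _ _ _ => mul_comm _ _)

protected theorem mul_assoc (a b c : FamilySemiring X Y) : a * b * c = a * (b * c) := by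
  obtain ⟨n, A, rfl⟩ := exists_rep a
  obtain ⟨m, B, rfl⟩ := exists_rep b
  obtain ⟨l, C, rfl⟩ := exists_rep c
  rw [mk_mul_mk, mk_mul_mk, mk_mul_mk, mk_mul_mk, mk_eq_mk]
  exact UEquiv.of_equiv (Equiv.prodAssoc _ _ _).symm (fun _ _ _ => mul_assoc _ _ _)
    (fun _ _ _ => mul_assoc _ _ _)

protected theorem one_mul (a : FamilySemiring X Y) : 1 * a = a := by
  obtain ⟨n, A, rfl⟩ := exists_rep a
  rw [one_def, mk_mul_mk, mk_eq_mk]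
  refine UEquiv.of_equiv (Equiv.punitProd _).symm ?_ ?_ <;> intro x i j
  · change (1 : Matrix Unit Unit ℂ) () () * _ = _
    rw [Matrix.one_apply_eq, _root_.one_mul]; rfl
  · change (1 : Matrix Unit Unit ℂ) () () * _ = _
    rw [Matrix.one_apply_eq, _root_.one_mul]; rfl

protected theorem zero_mul (a : FamilySemiring X Y) : 0 * a = 0 := by
  obtain ⟨n, A, rfl⟩ := exists_rep a
  rw [zero_def, mk_mul_mk, mk_eq_mk]
  exact UEquiv.of_equiv (Equiv.equivOfIsEmpty _ _) (fun _ i => i.elim) (fun _ i => i.elim)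

protected theorem add_mul (a b c : FamilySemiring X Y) : (a + b) * c = a * c + b * c := by
  obtain ⟨n, A, rfl⟩ := exists_rep a
  obtain ⟨m, B, rfl⟩ := exists_rep b
  obtain ⟨l, C, rfl⟩ := exists_rep c
  rw [mk_mul_mk, mk_mul_mk, mk_add_mk, mk_add_mk, mk_mul_mk, mk_eq_mk]
  refine UEquiv.of_equiv (Equiv.sumProdDistrib _ _ _).symm ?_ ?_
  · rintro x (i | i) (j | j)
    · rfl
    · exact MulZeroClass.zero_mul _
    · exact MulZeroClass.zero_mul _
    · rfl
  · rintro x (i | i) (j | j)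
    · rfl
    · exact MulZeroClass.zero_mul _
    · exact MulZeroClass.zero_mul _
    · rfl

instance : CommSemiring (FamilySemiring X Y) where
  add_assoc := FamilySemiring.add_assoc
  zero_add := FamilySemiring.zero_add
  add_zero a := by rw [FamilySemiring.add_comm, FamilySemiring.zero_add]
  add_comm := FamilySemiring.add_comm
  nsmul := nsmulRec
  mul_assoc := FamilySemiring.mul_assoc
  one_mul := FamilySemiring.one_mul
  mul_one a := by rw [FamilySemiring.mul_comm, FamilySemiring.one_mul]
  mul_comm := FamilySemiring.mul_comm
  zero_mul := FamilySemiring.zero_mul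
  mul_zero a := by rw [FamilySemiring.mul_comm, FamilySemiring.zero_mul]
  right_distrib := FamilySemiring.add_mul
  left_distrib a b c := by
    rw [FamilySemiring.mul_comm, FamilySemiring.add_mul, FamilySemiring.mul_comm b,
      FamilySemiring.mul_comm c]

/-- The preorder of the semiring: `a ≤ b` when `b` relatively submajorizes `a`. -/
instance : Preorder (FamilySemiring X Y) where
  le := Quotient.lift₂ (fun A B => Submajorizes B.2 A.2) (fun A B A' B' h h' => by
    have h : UEquiv A.2 A'.2 := h
    have h' : UEquiv B.2 B'.2 := h'
    exact propext ⟨fun k => (h'.symm.submajorizes.trans k).trans h.submajorizes,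
      fun k => (h'.submajorizes.trans k).trans h.symm.submajorizes⟩)
  le_refl a := by
    induction a using Quotient.ind with
    | _ A => exact (UEquiv.refl A.2).submajorizes
  le_trans a b c := by
    induction a using Quotient.ind with
    | _ A =>
      induction b using Quotient.ind with
      | _ B =>
        induction c using Quotient.ind with
        | _ C => exact fun h h' => Submajorizes.trans h' h

theorem mk_le_mk {A : FamilyPair X Y ι} {B : FamilyPair X Y κ} :
    mk A ≤ mk B ↔ Submajorizes B A :=
  ⟨fun h => ((UEquiv.reindex _ B).submajorizes.trans h).trans (UEquiv.reindex _ A).symm.submajorizes,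
    fun h => ((UEquiv.reindex _ B).symm.submajorizes.trans h).trans
      (UEquiv.reindex _ A).submajorizes⟩

variable (X Y) in
/-- The subsemiring of classical families: the one generated by the one-dimensional elements. -/
def classical : Subsemiring (FamilySemiring X Y) :=
  Subsemiring.closure {a | ∃ A : FamilyPair X Y Unit, a = mk A}

end FamilySemiring

variable (X Y) in
/-- The preordered semiring of classical pairs of families, with the semiring operations and the
preorder inherited from `FamilySemiring X Y`. -/
abbrev ClassicalSemiring : Type (max u v) := FamilySemiring.classical X Y

/-- The one-dimensional classical pair `(p, q)`. -/
def onedim (p : C(X, Set.Ioi (0 : ℝ))) (q : C(Y, Set.Ioi (0 : ℝ))) : ClassicalSemiring X Y :=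
  ⟨FamilySemiring.mk (FamilyPair.ofFun p q), Subsemiring.subset_closure ⟨_, rfl⟩⟩

/-- The classical pair `(⊕ᵢ pᵢ, ⊕ᵢ qᵢ)`. -/
def pairSum {d : ℕ} (p : Fin d → C(X, Set.Ioi (0 : ℝ))) (q : Fin d → C(Y, Set.Ioi (0 : ℝ))) :
    ClassicalSemiring X Y :=
  ∑ i, onedim (p i) (q i)

theorem onedim_mul (p p' : C(X, Set.Ioi (0 : ℝ))) (q q' : C(Y, Set.Ioi (0 : ℝ))) :
    onedim p q * onedim p' q' =
      onedim
        ⟨fun x => ⟨(p x : ℝ) * p' x, Set.mem_Ioi.2 (mul_pos (p x).2 (p' x).2)⟩,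
          Continuous.subtype_mk (by fun_prop) _⟩
        ⟨fun y => ⟨(q y : ℝ) * q' y, Set.mem_Ioi.2 (mul_pos (q y).2 (q' y).2)⟩,
          Continuous.subtype_mk (by fun_prop) _⟩ := by
  apply Subtype.ext
  change FamilySemiring.mk _ * FamilySemiring.mk _ = FamilySemiring.mk _
  rw [FamilySemiring.mk_mul_mk, FamilySemiring.mk_eq_mk]
  refine UEquiv.of_equiv (Equiv.punitProd _).symm ?_ ?_ <;> intro x i j <;>
    simp [FamilyPair.ofFun, FamilyPair.tens]

theorem onedim_one : onedim (ContinuousMap.const X ⟨1, Set.mem_Ioi.2 one_pos⟩)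
    (ContinuousMap.const Y ⟨1, Set.mem_Ioi.2 one_pos⟩) = 1 := by
  apply Subtype.ext
  change FamilySemiring.mk _ = FamilySemiring.mk _
  rw [FamilySemiring.mk_eq_mk]
  refine UEquiv.of_equiv (Equiv.refl _) ?_ ?_ <;> intro x i j <;>
    simp [FamilyPair.ofFun, FamilyPair.unit]

theorem exists_eq_onedim (A : FamilyPair X Y Unit) :
    ∃ p q, FamilySemiring.mk A = ((onedim p q : ClassicalSemiring X Y) : FamilySemiring X Y) := by
  have h1 : ∀ x, 0 < A.rho x () () := fun x => (A.rho_posDef x).diag_pos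
  have h2 : ∀ y, 0 < A.sigma y () () := fun y => (A.sigma_posDef y).diag_pos
  refine ⟨⟨fun x => ⟨(A.rho x () ()).re, (Complex.pos_iff.1 (h1 x)).1⟩, ?_⟩,
    ⟨fun y => ⟨(A.sigma y () ()).re, (Complex.pos_iff.1 (h2 y)).1⟩, ?_⟩, ?_⟩
  · exact (Complex.continuous_re.comp (A.rho.continuous.matrix_elem () ())).subtype_mk _
  · exact (Complex.continuous_re.comp (A.sigma.continuous.matrix_elem () ())).subtype_mk _
  · change _ = FamilySemiring.mk _
    rw [FamilySemiring.mk_eq_mk]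
    refine UEquiv.of_equiv (Equiv.refl _) (fun x i j => ?_) (fun y i j => ?_)
    · have : A.rho x () () = ((A.rho x () ()).re : ℂ) :=
        Complex.ext rfl (Complex.pos_iff.1 (h1 x)).2.symm
      simpa [FamilyPair.ofFun] using this
    · have : A.sigma y () () = ((A.sigma y () ()).re : ℂ) :=
        Complex.ext rfl (Complex.pos_iff.1 (h2 y)).2.symm
      simpa [FamilyPair.ofFun] using this

/-- Every classical pair of families is of the form `(⊕ᵢ pᵢ, ⊕ᵢ qᵢ)`. -/
theorem exists_eq_pairSum (s : ClassicalSemiring X Y) :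
    ∃ (d : ℕ) (p : Fin d → C(X, Set.Ioi (0 : ℝ))) (q : Fin d → C(Y, Set.Ioi (0 : ℝ))),
      s = pairSum p q := by
  let R : AddSubmonoid (ClassicalSemiring X Y) :=
    { carrier := {s | ∃ (d : ℕ) (p : Fin d → C(X, Set.Ioi (0 : ℝ)))
        (q : Fin d → C(Y, Set.Ioi (0 : ℝ))), s = pairSum p q}
      zero_mem' := ⟨0, Fin.elim0, Fin.elim0, by simp [pairSum]⟩
      add_mem' := by
        rintro _ _ ⟨d, p, q, rfl⟩ ⟨d', p', q', rfl⟩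
        exact ⟨d + d', Fin.append p p', Fin.append q q', by simp [pairSum, Fin.sum_univ_add]⟩ }
  have hone : ∀ p q, onedim p q ∈ R := fun p q =>
    ⟨1, fun _ => p, fun _ => q, by simp [pairSum]⟩
  obtain ⟨s, hs⟩ := s
  change (⟨s, hs⟩ : ClassicalSemiring X Y) ∈ R
  induction hs using Subsemiring.closure_induction with
  | mem x hx =>
    obtain ⟨A, rfl⟩ := hx
    obtain ⟨p, q, h⟩ := exists_eq_onedim A
    have h' : (⟨FamilySemiring.mk A, Subsemiring.subset_closure ⟨A, rfl⟩⟩ :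
      ClassicalSemiring X Y) = onedim p q := Subtype.ext h
    exact h' ▸ hone p q
  | zero => exact R.zero_mem
  | one =>
    change (1 : ClassicalSemiring X Y) ∈ R
    exact onedim_one (X := X) (Y := Y) ▸ hone _ _
  | add x y hx hy h h' => exact R.add_mem h h'
  | mul x y hx hy h h' =>
    obtain ⟨d, p, q, hp⟩ := h
    obtain ⟨d', p', q', hp'⟩ := h'
    have : (⟨x * y, Subsemiring.mul_mem _ hx hy⟩ : ClassicalSemiring X Y) =
      pairSum p q * pairSum p' q' := by rw [← hp, ← hp']; rfl
    change (⟨x * y, Subsemiring.mul_mem _ hx hy⟩ : ClassicalSemiring X Y) ∈ R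
    rw [this, pairSum, pairSum, Finset.sum_mul_sum]
    refine R.sum_mem fun i _ => R.sum_mem fun j _ => ?_
    rw [onedim_mul]
    exact hone _ _

variable (X Y) in
/-- The power universal element `u = (2, 1)`. -/
def powerUniversal : ClassicalSemiring X Y :=
  onedim (ContinuousMap.const X ⟨2, Set.mem_Ioi.2 two_pos⟩)
    (ContinuousMap.const Y ⟨1, Set.mem_Ioi.2 one_pos⟩)

end Families

/-- The tropical real semiring in the multiplicative picture: the set of nonnegative reals with
`max` as addition, the usual multiplication and the usual order. -/
@[ext] structure TropicalReal where
  val : ℝ≥0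

namespace TropicalReal

instance : Zero TropicalReal := ⟨⟨0⟩⟩

instance : One TropicalReal := ⟨⟨1⟩⟩

instance : Add TropicalReal := ⟨fun a b => ⟨max a.val b.val⟩⟩

instance : Mul TropicalReal := ⟨fun a b => ⟨a.val * b.val⟩⟩

instance : PartialOrder TropicalReal where
  le a b := a.val ≤ b.val
  le_refl a := le_refl a.val
  le_trans a b c h h' := le_trans (α := ℝ≥0) h h'
  le_antisymm a b h h' := TropicalReal.ext (le_antisymm h h')

theorem le_def {a b : TropicalReal} : a ≤ b ↔ a.val ≤ b.val := Iff.rfl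

@[simp] theorem zero_val : (0 : TropicalReal).val = 0 := rfl

@[simp] theorem one_val : (1 : TropicalReal).val = 1 := rfl

@[simp] theorem add_val (a b : TropicalReal) : (a + b).val = max a.val b.val := rfl

@[simp] theorem mul_val (a b : TropicalReal) : (a * b).val = a.val * b.val := rfl

instance : CommSemiring TropicalReal where
  add_assoc a b c := by ext; simp [max_assoc]
  zero_add a := by ext; simp
  add_zero a := by ext; simp
  add_comm a b := by ext; simp [max_comm]
  nsmul := nsmulRec
  mul_assoc a b c := by ext; simp [mul_assoc]
  one_mul a := by ext; simp
  mul_one a := by ext; simp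
  mul_comm a b := by ext; simp [mul_comm]
  zero_mul a := by ext; simp
  mul_zero a := by ext; simp
  left_distrib a b c := by ext; simp [mul_max]
  right_distrib a b c := by ext; simp [max_mul]

end TropicalReal

/-- The 1-test spectrum of a preordered semiring `S` with power universal element `u`: the disjoint
union of the set of monotone semiring homomorphisms `S → ℝ≥0` and of the set of monotone semiring
homomorphisms `f` from `S` to the tropical reals with `f u = 2`. The normalization uses the number
`2` (not the sum `1 + 1` of the tropical semiring, which is `1`). -/
abbrev TSper₁ (S : Type*) [CommSemiring S] [Preorder S] (u : S) :=
  (S →+*o ℝ≥0) ⊕ {f : S →+*o TropicalReal // (f u).val = 2}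

end

/-! Every classical pair is a finite sum of one-dimensional pairs `(p, q)`, so a homomorphism `f` is
determined by its values there. Such pairs are invertible, hence `f` does not vanish on them, and
monotonicity and multiplicativity give `f (p, q) = exp (A (log p) - B (log q))` with `A`, `B`
monotone and additive (`exists_log_additive`). Put `α = A 1` and `β = B 1`.

Two comparisons pin down `A` and `B`. First, `(1/2, 1/2) + (1/2, 1/2)` and `1` dominate each other
(`half_add_half`). For a real point this forces `α = 1 + β`; for a tropical point it forces `α = β`,
and `f u = 2` gives `α = 1`. Second, a sum of two one-dimensional pairs dominates the pair of sums
(`onedim_le_add`). With well-chosen constants in the second component this makes `exp ∘ (A / α) ∘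
log` subadditive, and on a compact space only point evaluations have this property
(`exists_eval_eq`). Nothing comparable constrains `B`: when `β > 0`, `B / β` is an arbitrary
normalized positive functional, which is integration against a probability measure by
Riesz–Markov–Kakutani (`exists_integral_eq`).

Conversely, a channel between classical pairs yields a substochastic matrix
(`exists_substochastic_of_le`). Monotonicity of the formulas then follows from the joint convexity
of `a ^ α * b ^ (1 - α)` (`rpow_mul_rpow_le_sum`) and the superadditivity of the geometric mean
(`sum_mul_geomMean_le`). Well-definedness is a consequence of monotonicity (`exists_orderRingHom`).
-/

noncomputable section

namespace Families

open Matrix FamilyPair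
open scoped Matrix.Norms.L2Operator MatrixOrder ComplexOrder CStarAlgebra Kronecker

/-! ### Completely positive maps: the trace and the scalar embedding -/

section Channels

variable {ι κ : Type} [Fintype ι] [DecidableEq ι] [Fintype κ] [DecidableEq κ]

/-- A linear map is completely positive as soon as its amplifications are nonnegative on the
elements `star N * N`. -/
theorem map_nonneg_of_star_mul_self {k : ℕ} (T : Matrix ι ι ℂ →ₗ[ℂ] Matrix κ κ ℂ)
    (h : ∀ N : CStarMatrix (Fin k) (Fin k) (Matrix ι ι ℂ), 0 ≤ (star N * N).map T)
    (M : CStarMatrix (Fin k) (Fin k) (Matrix ι ι ℂ)) (hM : 0 ≤ M) : 0 ≤ M.map T := by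
  rw [StarOrderedRing.nonneg_iff] at hM
  induction hM using AddSubmonoid.closure_induction with
  | mem x hx => obtain ⟨N, rfl⟩ := hx; exact h N
  | zero =>
    have : (0 : CStarMatrix (Fin k) (Fin k) (Matrix ι ι ℂ)).map T = 0 :=
      CStarMatrix.ext fun i j => map_zero T
    rw [this]
  | add x y _ _ hx hy =>
    have : (x + y).map T = x.map T + y.map T := CStarMatrix.ext fun i j => map_add T _ _
    rw [this]
    exact add_nonneg hx hy

/-- The trace, as a linear map to `1 × 1` matrices. -/
def traceLin (ι : Type) [Fintype ι] : Matrix ι ι ℂ →ₗ[ℂ] Matrix Unit Unit ℂ where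
  toFun M := of fun _ _ => M.trace
  map_add' M N := by ext; simp
  map_smul' c M := by ext; simp

/-- The trace, as a completely positive map. -/
def traceCP (ι : Type) [Fintype ι] [DecidableEq ι] : Matrix ι ι ℂ →CP Matrix Unit Unit ℂ where
  __ := traceLin ι
  map_cstarMatrix_nonneg' k := map_nonneg_of_star_mul_self _ fun N => by
    -- The trace of `Mᴴ * M'` is the sum over all matrix positions of conjugated entry times entry.
    -- Collecting the `l`-entries of the blocks of `N` into `R l` thus writes the image of `star N *
    -- N` as a sum of squares.
    obtain ⟨R, hR⟩ : ∃ R : ι × ι → CStarMatrix (Fin k) (Fin k) (Matrix Unit Unit ℂ),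
        ∀ l c a, R l c a = of fun _ _ => N c a l.1 l.2 :=
      ⟨fun l => CStarMatrix.ofMatrix fun c a => of fun _ _ => N c a l.1 l.2, fun _ _ _ => rfl⟩
    have key : (star N * N).map (traceLin ι) = ∑ l, star (R l) * R l := by
      refine CStarMatrix.ext fun a b => ?_
      have h1 : (∑ l, star (R l) * R l) a b = ∑ l, (star (R l) * R l) a b :=
        map_sum (⟨⟨fun M : CStarMatrix (Fin k) (Fin k) (Matrix Unit Unit ℂ) => M a b, rfl⟩,
          fun _ _ => rfl⟩ : _ →+ Matrix Unit Unit ℂ) _ _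
      rw [h1]
      ext
      simp only [CStarMatrix.map_apply, CStarMatrix.mul_apply, CStarMatrix.star_apply,
        Matrix.sum_apply, traceLin, LinearMap.coe_mk, AddHom.coe_mk, of_apply,
        Matrix.mul_apply, Matrix.trace, Matrix.diag_apply, star_eq_conjTranspose,
        conjTranspose_apply, hR, Fintype.sum_prod_type, Finset.univ_unique, Finset.sum_singleton]
      rw [Finset.sum_comm]
      refine (Finset.sum_congr rfl fun i _ => Finset.sum_comm).trans Finset.sum_comm |>.trans ?_
      exact Finset.sum_congr rfl fun i _ => Finset.sum_comm
    change 0 ≤ (star N * N).map (traceLin ι)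
    rw [key]
    exact Finset.sum_nonneg fun l _ => star_mul_self_nonneg _

theorem traceCP_apply (M : Matrix ι ι ℂ) (i j : Unit) : traceCP ι M i j = M.trace := rfl

/-- The scalar embedding `c ↦ r c 1` of `ℂ` into `Matrix κ κ ℂ`, as a linear map. -/
def scalarLin (κ : Type) [Fintype κ] [DecidableEq κ] (r : ℝ≥0) :
    Matrix Unit Unit ℂ →ₗ[ℂ] Matrix κ κ ℂ where
  toFun M := diagonal fun _ => ((r : ℝ) : ℂ) * M () ()
  map_add' M N := by ext i j; by_cases h : i = j <;> simp [h, mul_add]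
  map_smul' c M := by ext i j; by_cases h : i = j <;> simp [h, mul_left_comm]

/-- The scalar embedding `c ↦ r c 1` of `ℂ` into `Matrix κ κ ℂ`, as a completely positive map. -/
def scalarCP (κ : Type) [Fintype κ] [DecidableEq κ] (r : ℝ≥0) :
    Matrix Unit Unit ℂ →CP Matrix κ κ ℂ where
  __ := scalarLin κ r
  map_cstarMatrix_nonneg' k := map_nonneg_of_star_mul_self _ fun N => by
    -- Half of the factor `r` goes to each side as `√r`, so the image is again a single square.
    obtain ⟨R, hR⟩ : ∃ R : CStarMatrix (Fin k) (Fin k) (Matrix κ κ ℂ),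
        ∀ c a, R c a = diagonal fun _ => ((NNReal.sqrt r : ℝ) : ℂ) * N c a () () :=
      ⟨CStarMatrix.ofMatrix fun c a => diagonal fun _ => ((NNReal.sqrt r : ℝ) : ℂ) * N c a () (),
        fun _ _ => rfl⟩
    have hr : ((r : ℝ) : ℂ) = ((NNReal.sqrt r : ℝ) : ℂ) * ((NNReal.sqrt r : ℝ) : ℂ) := by
      rw [← Complex.ofReal_mul, ← NNReal.coe_mul, NNReal.mul_self_sqrt]
    have key : (star N * N).map (scalarLin κ r) = star R * R := by
      refine CStarMatrix.ext fun a b => ?_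
      simp only [CStarMatrix.map_apply, CStarMatrix.mul_apply, CStarMatrix.star_apply, map_sum]
      refine Finset.sum_congr rfl fun c _ => ?_
      simp only [scalarLin, LinearMap.coe_mk, AddHom.coe_mk, hR,
        star_eq_conjTranspose, diagonal_conjTranspose, diagonal_mul_diagonal, Matrix.mul_apply,
        Finset.univ_unique, Finset.sum_singleton, conjTranspose_apply, hr]
      congr 1
      funext _
      simp
      ring
    change 0 ≤ (star N * N).map (scalarLin κ r)
    rw [key]
    exact star_mul_self_nonneg _

theorem scalarCP_apply (r : ℝ≥0) (M : Matrix Unit Unit ℂ) :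
    scalarCP κ r M = diagonal fun _ => ((r : ℝ) : ℂ) * M () () := rfl

omit [Fintype κ] [DecidableEq κ] in
theorem apply_diag_le_of_le {M N : Matrix κ κ ℂ} (h : M ≤ N) (j : κ) :
    (M j j).re ≤ (N j j).re := by
  have := (Matrix.le_iff.1 h).diag_nonneg (i := j)
  have := (Complex.nonneg_iff.1 this).1
  simpa using this

end Channels

/-! ### Submajorization between classical pairs -/

variable {X Y : Type*} [TopologicalSpace X] [TopologicalSpace Y]

/-- The diagonal pair of families with diagonal entries `p` and `q`. -/
def diagFamily {d : ℕ} (p : Fin d → C(X, Set.Ioi (0 : ℝ))) (q : Fin d → C(Y, Set.Ioi (0 : ℝ))) :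
    FamilyPair X Y (Fin d) where
  rho := ⟨fun x => diagonal fun i => ((p i x : ℝ) : ℂ), by fun_prop⟩
  sigma := ⟨fun y => diagonal fun i => ((q i y : ℝ) : ℂ), by fun_prop⟩
  rho_posDef x := posDef_diagonal_iff.2 fun i => Complex.zero_lt_real.2 (p i x).2
  sigma_posDef y := posDef_diagonal_iff.2 fun i => Complex.zero_lt_real.2 (q i y).2

/-- The diagonal form lets a channel between classical pairs be read off from its matrix entries. -/
theorem coe_pairSum {d : ℕ} (p : Fin d → C(X, Set.Ioi (0 : ℝ)))
    (q : Fin d → C(Y, Set.Ioi (0 : ℝ))) :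
    (pairSum p q : FamilySemiring X Y) = FamilySemiring.mk (diagFamily p q) := by
  induction d with
  | zero =>
    simp only [pairSum, Finset.univ_eq_empty, Finset.sum_empty]
    change FamilySemiring.mk _ = _
    rw [FamilySemiring.mk_eq_mk]
    exact UEquiv.of_equiv (Equiv.equivOfIsEmpty _ _) (fun _ i => i.elim0) (fun _ i => i.elim0)
  | succ d ih =>
    have h : (pairSum p q : FamilySemiring X Y) = FamilySemiring.mk (ofFun (p 0) (q 0)) +
        (pairSum (fun i => p i.succ) (fun i => q i.succ) : ClassicalSemiring X Y) := by
      rw [pairSum, Fin.sum_univ_succ]; rfl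
    rw [h, ih, FamilySemiring.mk_add_mk, FamilySemiring.mk_eq_mk]
    refine UEquiv.of_equiv
      ⟨Fin.cases (Sum.inl ()) Sum.inr, Sum.elim (fun _ => 0) Fin.succ, ?_, ?_⟩ ?_ ?_
    · intro i; cases i using Fin.cases <;> rfl
    · rintro (i | i) <;> rfl
    · intro x i j
      cases i using Fin.cases <;> cases j using Fin.cases <;>
        simp [FamilyPair.dsum, ofFun, diagFamily, diagonal_apply, Fin.succ_ne_zero,
          (Fin.succ_ne_zero _).symm]
    · intro x i j
      cases i using Fin.cases <;> cases j using Fin.cases <;>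
        simp [FamilyPair.dsum, ofFun, diagFamily, diagonal_apply, Fin.succ_ne_zero,
          (Fin.succ_ne_zero _).symm]

/-- Relative submajorization of classical families is implemented by a substochastic matrix. -/
theorem exists_substochastic_of_le {d d' : ℕ} {p : Fin d → C(X, Set.Ioi (0 : ℝ))}
    {q : Fin d → C(Y, Set.Ioi (0 : ℝ))} {p' : Fin d' → C(X, Set.Ioi (0 : ℝ))}
    {q' : Fin d' → C(Y, Set.Ioi (0 : ℝ))} (h : pairSum p' q' ≤ pairSum p q) :
    ∃ t : Fin d' → Fin d → ℝ, (∀ j i, 0 ≤ t j i) ∧ (∀ i, ∑ j, t j i ≤ 1) ∧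
      (∀ x j, (p' j x : ℝ) ≤ ∑ i, t j i * p i x) ∧
      (∀ y j, ∑ i, t j i * q i y ≤ (q' j y : ℝ)) := by
  have h' : (pairSum p' q' : FamilySemiring X Y) ≤ (pairSum p q : ClassicalSemiring X Y) := h
  rw [coe_pairSum, coe_pairSum, FamilySemiring.mk_le_mk] at h'
  obtain ⟨T, h1, h2, h3⟩ := h'
  have hE : ∀ i, (0 : Matrix (Fin d) (Fin d) ℂ) ≤ diagonal (Pi.single i 1) := fun i => by
    rw [Matrix.nonneg_iff_posSemidef, posSemidef_diagonal_iff]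
    intro k
    by_cases hk : k = i
    · subst hk; simp
    · simp [hk]
  -- By linearity, the diagonal of the image of a diagonal matrix depends only on the images of the
  -- diagonal matrix units.
  have hT : ∀ (v : Fin d → ℝ) (j : Fin d'), (T (diagonal fun i => (v i : ℂ)) j j).re =
      ∑ i, (T (diagonal (Pi.single i 1)) j j).re * v i := fun v j => by
    have : (diagonal fun i => (v i : ℂ)) = ∑ i, (v i : ℂ) • diagonal (Pi.single i (1 : ℂ)) := by
      ext a b
      by_cases hab : a = b
      · subst hab
        simp [Matrix.sum_apply, Pi.single_apply]
      · simp [Matrix.sum_apply, hab]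
    rw [this, map_sum, Matrix.sum_apply, Complex.re_sum]
    refine Finset.sum_congr rfl fun i _ => ?_
    rw [map_smul, Matrix.smul_apply, smul_eq_mul, Complex.re_ofReal_mul, mul_comm]
  -- The transition weight from `i` to `j` is the `j`-th diagonal entry of the image of the `i`-th
  -- unit. Positivity makes it nonnegative, and the trace condition on that unit bounds the sum over
  -- `j`.
  refine ⟨fun j i => (T (diagonal (Pi.single i 1)) j j).re, fun j i => ?_, fun i => ?_,
    fun x j => ?_, fun y j => ?_⟩
  · simpa using apply_diag_le_of_le (map_nonneg T (hE i)) j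
  · have := (Complex.le_def.1 (h1 _ (hE i))).1
    simpa [Matrix.trace, Finset.sum_pi_single'] using this
  · have := apply_diag_le_of_le (h2 x) j
    rw [show (diagFamily p q).rho x = diagonal fun i => ((p i x : ℝ) : ℂ) from rfl, hT] at this
    simpa [diagFamily] using this
  · have := apply_diag_le_of_le (h3 y) j
    rw [show (diagFamily p q).sigma y = diagonal fun i => ((q i y : ℝ) : ℂ) from rfl, hT] at this
    simpa [diagFamily] using this

theorem onedim_mono {p p' : C(X, Set.Ioi (0 : ℝ))} {q q' : C(Y, Set.Ioi (0 : ℝ))}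
    (hp : ∀ x, (p x : ℝ) ≤ p' x) (hq : ∀ y, (q' y : ℝ) ≤ q y) : onedim p q ≤ onedim p' q' := by
  change FamilySemiring.mk _ ≤ FamilySemiring.mk _
  rw [FamilySemiring.mk_le_mk]
  -- In dimension one the scalar embedding with factor `1` is the identity channel.
  refine ⟨scalarCP Unit 1, fun M hM => ?_, fun x => ?_, fun y => ?_⟩
  · simp [scalarCP_apply, Matrix.trace]
  · rw [Matrix.le_iff, scalarCP_apply]
    simp only [ofFun, ContinuousMap.coe_mk, diagonal_sub, posSemidef_diagonal_iff]
    intro _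
    simpa using hp x
  · rw [Matrix.le_iff, scalarCP_apply]
    simp only [ofFun, ContinuousMap.coe_mk, diagonal_sub, posSemidef_diagonal_iff]
    intro _
    simpa using hq y

/-- Adding up the components of a classical pair coarsens it. -/
theorem onedim_le_add {p p₁ p₂ : C(X, Set.Ioi (0 : ℝ))} {q q₁ q₂ : C(Y, Set.Ioi (0 : ℝ))}
    (hp : ∀ x, (p x : ℝ) ≤ p₁ x + p₂ x) (hq : ∀ y, (q₁ y : ℝ) + q₂ y ≤ q y) :
    onedim p q ≤ onedim p₁ q₁ + onedim p₂ q₂ := by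
  change FamilySemiring.mk _ ≤ FamilySemiring.mk _ + FamilySemiring.mk _
  rw [FamilySemiring.mk_add_mk, FamilySemiring.mk_le_mk]
  refine ⟨traceCP _, fun M hM => ?_, fun x => ?_, fun y => ?_⟩
  · simp [Matrix.trace, traceCP_apply]
  · have : traceCP _ (((ofFun p₁ q₁).dsum (ofFun p₂ q₂)).rho x) =
        diagonal fun _ => ((p₁ x + p₂ x : ℝ) : ℂ) := by
      ext
      simp [traceCP_apply, FamilyPair.dsum, ofFun, Matrix.trace]
    rw [this, Matrix.le_iff]
    simp only [ofFun, ContinuousMap.coe_mk, diagonal_sub, posSemidef_diagonal_iff]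
    intro _
    rw [← Complex.ofReal_sub]
    exact Complex.zero_le_real.2 (sub_nonneg.2 (hp x))
  · have : traceCP _ (((ofFun p₁ q₁).dsum (ofFun p₂ q₂)).sigma y) =
        diagonal fun _ => ((q₁ y + q₂ y : ℝ) : ℂ) := by
      ext
      simp [traceCP_apply, FamilyPair.dsum, ofFun, Matrix.trace]
    rw [this, Matrix.le_iff]
    simp only [ofFun, ContinuousMap.coe_mk, diagonal_sub, posSemidef_diagonal_iff]
    intro _
    rw [← Complex.ofReal_sub]
    exact Complex.zero_le_real.2 (sub_nonneg.2 (hq y))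

/-- A one-dimensional pair can be split into two halves. -/
theorem half_add_half_le {p p' : C(X, Set.Ioi (0 : ℝ))} {q q' : C(Y, Set.Ioi (0 : ℝ))}
    (hp : ∀ x, (p x : ℝ) ≤ p' x / 2) (hq : ∀ y, (q' y : ℝ) / 2 ≤ q y) :
    onedim p q + onedim p q ≤ onedim p' q' := by
  change FamilySemiring.mk _ + FamilySemiring.mk _ ≤ FamilySemiring.mk _
  rw [FamilySemiring.mk_add_mk, FamilySemiring.mk_le_mk]
  have hd : ∀ a b : ℂ, fromBlocks (diagonal fun _ : Unit => a) 0 0 (diagonal fun _ : Unit => b) =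
      diagonal (Sum.elim (fun _ => a) fun _ => b) := fun a b => fromBlocks_diagonal _ _
  -- The factor `1 / 2` spreads the mass evenly over two coordinates and preserves the trace.
  refine ⟨scalarCP _ (1 / 2), fun M hM => ?_, fun x => ?_, fun y => ?_⟩
  · simp [scalarCP_apply, Matrix.trace]
  · rw [Matrix.le_iff, scalarCP_apply]
    simp only [ofFun, FamilyPair.dsum, ContinuousMap.coe_mk, hd, diagonal_sub,
      posSemidef_diagonal_iff, diagonal_apply_eq]
    have := Complex.zero_le_real.2 (sub_nonneg.2 (hp x))
    rintro (_ | _) <;> simpa [div_eq_inv_mul] using this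
  · rw [Matrix.le_iff, scalarCP_apply]
    simp only [ofFun, FamilyPair.dsum, ContinuousMap.coe_mk, hd, diagonal_sub,
      posSemidef_diagonal_iff, diagonal_apply_eq]
    have := Complex.zero_le_real.2 (sub_nonneg.2 (hq y))
    rintro (_ | _) <;> simpa [div_eq_inv_mul] using this

end Families

/-- Both sides have the same upper bounds. The real supremum over an empty index type is `0`, the
tropical zero, so `d = 0` fits as well; the conjunct `0 ≤ c` below accounts for it. -/
theorem TropicalReal.val_sum {d : ℕ} (g : Fin d → TropicalReal) :
    (((∑ i, g i).val : ℝ≥0) : ℝ) = ⨆ i, ((g i).val : ℝ) := by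
  have h : ∀ (c : ℝ) (s : Finset (Fin d)), (((∑ i ∈ s, g i).val : ℝ≥0) : ℝ) ≤ c ↔
      0 ≤ c ∧ ∀ i ∈ s, ((g i).val : ℝ) ≤ c := fun c s => by
    induction s using Finset.cons_induction with
    | empty => simp
    | cons i s hi ih =>
      rw [Finset.sum_cons, TropicalReal.add_val, NNReal.coe_max, max_le_iff, ih]
      simp only [Finset.mem_cons, forall_eq_or_imp]
      tauto
  refine le_antisymm ((h _ _).2 ⟨Real.iSup_nonneg fun i => NNReal.coe_nonneg _, fun i _ =>
    le_ciSup (f := fun i => ((g i).val : ℝ)) (Set.finite_range _).bddAbove i⟩) ?_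
  exact Real.iSup_le (fun i => ((h _ _).1 le_rfl).2 i (Finset.mem_univ i)) (NNReal.coe_nonneg _)

namespace Families

open MeasureTheory

/-! ### Convexity inequalities and the geometric mean -/

section Inequalities

/-- Joint convexity of `(a, b) ↦ a ^ α * b ^ (1 - α)` for `1 ≤ α`. -/
theorem rpow_mul_rpow_le_sum {ι : Type*} [Fintype ι] {α P Q : ℝ} {t a b : ι → ℝ} (hα : 1 ≤ α)
    (ht : ∀ i, 0 ≤ t i) (ha : ∀ i, 0 < a i) (hb : ∀ i, 0 < b i) (hP : 0 < P)
    (hPa : P ≤ ∑ i, t i * a i) (hbQ : ∑ i, t i * b i ≤ Q) :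
    P ^ α * Q ^ (1 - α) ≤ ∑ i, t i * (a i ^ α * b i ^ (1 - α)) := by
  set S := ∑ i, t i * b i with hS
  have hS0 : 0 < S := by
    refine Finset.sum_pos' (fun i _ => mul_nonneg (ht i) (hb i).le) ?_
    -- If no term is positive, all `t i` vanish and `hPa` contradicts `hP`.
    by_contra! h
    have : ∑ i, t i * a i ≤ 0 := Finset.sum_nonpos fun i hi => by
      have : t i = 0 := le_antisymm
        (nonpos_of_mul_nonpos_left (h i hi) (hb i)) (ht i)
      simp [this]
    linarith
  have hw : ∑ i, t i * b i / S = 1 := by rw [← Finset.sum_div, div_self hS0.ne']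
  -- The function is the perspective of `x ↦ x ^ α`, so Jensen is applied at the ratios `a i / b i`
  -- with weights proportional to `t i * b i`.
  have jensen := Real.rpow_arith_mean_le_arith_mean_rpow Finset.univ (fun i => t i * b i / S)
    (fun i => a i / b i) (fun i _ => div_nonneg (mul_nonneg (ht i) (hb i).le) hS0.le) hw
    (fun i _ => (div_pos (ha i) (hb i)).le) hα
  have e1 : ∑ i, t i * b i / S * (a i / b i) = (∑ i, t i * a i) / S := by
    rw [Finset.sum_div]
    refine Finset.sum_congr rfl fun i _ => ?_
    have := (hb i).ne'
    field_simp
  have e2 : ∀ i, t i * (a i ^ α * b i ^ (1 - α)) = S * (t i * b i / S * (a i / b i) ^ α) := by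
    intro i
    rw [Real.div_rpow (ha i).le (hb i).le, Real.rpow_sub (hb i), Real.rpow_one]
    have := (hb i).ne'
    have := (Real.rpow_pos_of_pos (hb i) α).ne'
    field_simp
  rw [e1] at jensen
  simp only [e2, ← Finset.mul_sum]
  calc P ^ α * Q ^ (1 - α) ≤ (∑ i, t i * a i) ^ α * S ^ (1 - α) :=
        mul_le_mul (Real.rpow_le_rpow hP.le hPa (by linarith))
          (Real.rpow_le_rpow_of_nonpos hS0 hbQ (by linarith))
          (Real.rpow_nonneg (hS0.le.trans hbQ) _) (Real.rpow_nonneg (hP.le.trans hPa) _)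
    _ = S * ((∑ i, t i * a i) / S) ^ α := by
        rw [Real.div_rpow (hP.le.trans hPa) hS0.le, Real.rpow_sub hS0, Real.rpow_one]
        have := (Real.rpow_pos_of_pos hS0 α).ne'
        field_simp
    _ ≤ _ := mul_le_mul_of_nonneg_left jensen hS0.le

variable {Y : Type*} [TopologicalSpace Y] [CompactSpace Y] [MeasurableSpace Y] [BorelSpace Y]

theorem integrable_log (γ : Measure Y) [IsFiniteMeasure γ] (q : C(Y, Set.Ioi (0 : ℝ))) :
    Integrable (fun y => Real.log (q y)) γ := by
  have hc : Continuous fun y => Real.log (q y) :=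
    Continuous.log (by fun_prop) fun y => (q y).2.ne'
  exact hc.integrable_of_hasCompactSupport (HasCompactSupport.of_compactSpace _)

/-- The geometric mean of a strictly positive continuous function. -/
def geomMean (γ : Measure Y) (q : C(Y, Set.Ioi (0 : ℝ))) : ℝ :=
  Real.exp (∫ y, Real.log (q y : ℝ) ∂γ)

omit [CompactSpace Y] [BorelSpace Y] in
theorem geomMean_pos (γ : Measure Y) (q : C(Y, Set.Ioi (0 : ℝ))) : 0 < geomMean γ q :=
  Real.exp_pos _

/-- The geometric mean is superadditive. -/
theorem sum_mul_geomMean_le {ι : Type*} [Fintype ι] (γ : Measure Y) [IsProbabilityMeasure γ]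
    {t : ι → ℝ} {q : ι → C(Y, Set.Ioi (0 : ℝ))} {q' : C(Y, Set.Ioi (0 : ℝ))}
    (ht : ∀ i, 0 ≤ t i) (h : ∀ y, ∑ i, t i * q i y ≤ (q' y : ℝ)) :
    ∑ i, t i * geomMean γ (q i) ≤ geomMean γ q' := by
  obtain ⟨S, hS⟩ : ∃ S, S = ∑ i, t i * geomMean γ (q i) := ⟨_, rfl⟩
  rw [← hS]
  rcases (hS ▸ Finset.sum_nonneg fun i _ => mul_nonneg (ht i) (geomMean_pos γ (q i)).le :
    0 ≤ S).eq_or_lt with h0 | h0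
  · rw [← h0]; exact (geomMean_pos γ q').le
  have hw : ∑ i, t i * geomMean γ (q i) / S = 1 := by rw [← Finset.sum_div, ← hS, div_self h0.ne']
  -- Weighted AM–GM for the normalized functions `q i / geomMean γ (q i)`, with weights `t i *
  -- geomMean γ (q i) / S`. Their logarithms have integral zero, so integrating leaves only `log S`
  -- on the left.
  have pt : ∀ y, Real.log S + ∑ i, t i * geomMean γ (q i) / S *
      (Real.log (q i y) - Real.log (geomMean γ (q i))) ≤ Real.log (q' y) := by
    intro y
    have jensen := convexOn_exp.map_sum_le (t := Finset.univ)
      (w := fun i => t i * geomMean γ (q i) / S)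
      (p := fun i => Real.log (q i y) - Real.log (geomMean γ (q i)))
      (fun i _ => div_nonneg (mul_nonneg (ht i) (geomMean_pos γ (q i)).le) h0.le) hw
      (fun i _ => Set.mem_univ _)
    simp only [smul_eq_mul] at jensen
    rw [Real.le_log_iff_exp_le (q' y).2, Real.exp_add, Real.exp_log h0]
    refine (mul_le_mul_of_nonneg_left jensen h0.le).trans (le_trans (le_of_eq ?_) (h y))
    rw [Finset.mul_sum]
    refine Finset.sum_congr rfl fun i _ => ?_
    rw [Real.exp_sub, Real.exp_log (q i y).2, Real.exp_log (geomMean_pos γ (q i))]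
    have := (geomMean_pos γ (q i)).ne'
    field_simp
  have hint : ∀ i, Integrable (fun y => t i * geomMean γ (q i) / S *
      (Real.log (q i y) - Real.log (geomMean γ (q i)))) γ := fun i =>
    ((integrable_log γ (q i)).sub (integrable_const _)).const_mul _
  have := integral_mono (f := fun y => Real.log S + ∑ i, t i * geomMean γ (q i) / S *
      (Real.log (q i y) - Real.log (geomMean γ (q i)))) ((integrable_const _).add (integrable_finsetSum Finset.univ
    fun i _ => hint i)) (integrable_log γ q') pt
  rw [integral_add (integrable_const _) (integrable_finsetSum _ fun i _ => hint i),
    integral_finsetSum _ fun i _ => hint i] at this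
  have hz : ∀ i, ∫ y, t i * geomMean γ (q i) / S *
      (Real.log (q i y) - Real.log (geomMean γ (q i))) ∂γ = 0 := fun i => by
    rw [integral_const_mul, integral_sub (integrable_log γ (q i)) (integrable_const _)]
    simp [geomMean]
  simp only [hz, integral_const, Finset.sum_const_zero, add_zero, probReal_univ, one_smul] at this
  rwa [geomMean, ← Real.log_le_iff_le_exp h0]

theorem geomMean_mul (γ : Measure Y) [IsFiniteMeasure γ] {q q' Q : C(Y, Set.Ioi (0 : ℝ))}
    (h : ∀ y, (Q y : ℝ) = q y * q' y) : geomMean γ Q = geomMean γ q * geomMean γ q' := by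
  rw [geomMean, geomMean, geomMean, ← Real.exp_add,
    ← integral_add (integrable_log γ q) (integrable_log γ q')]
  congr 2
  funext y
  rw [h, Real.log_mul (q y).2.ne' (q' y).2.ne']

omit [CompactSpace Y] [BorelSpace Y] in
theorem geomMean_one (γ : Measure Y) {q : C(Y, Set.Ioi (0 : ℝ))} (h : ∀ y, (q y : ℝ) = 1) :
    geomMean γ q = 1 := by
  simp [geomMean, h]

end Inequalities

/-! ### The formulas define spectral points -/

section Construction

variable {X Y : Type*} [TopologicalSpace X] [TopologicalSpace Y]

/-- The pointwise product of strictly positive continuous functions. -/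
def mulMap (p p' : C(X, Set.Ioi (0 : ℝ))) : C(X, Set.Ioi (0 : ℝ)) :=
  ⟨fun x => ⟨(p x : ℝ) * p' x, Set.mem_Ioi.2 (mul_pos (p x).2 (p' x).2)⟩,
    Continuous.subtype_mk (by fun_prop) _⟩

theorem pairSum_mul {d d' : ℕ} (p : Fin d → C(X, Set.Ioi (0 : ℝ)))
    (q : Fin d → C(Y, Set.Ioi (0 : ℝ))) (p' : Fin d' → C(X, Set.Ioi (0 : ℝ)))
    (q' : Fin d' → C(Y, Set.Ioi (0 : ℝ))) :
    pairSum p q * pairSum p' q' =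
      pairSum (fun k : Fin (d * d') => mulMap (p (finProdFinEquiv.symm k).1)
          (p' (finProdFinEquiv.symm k).2))
        (fun k => mulMap (q (finProdFinEquiv.symm k).1) (q' (finProdFinEquiv.symm k).2)) := by
  rw [pairSum, pairSum, pairSum, Finset.sum_mul_sum, ← Finset.sum_product', Finset.univ_product_univ,
    ← finProdFinEquiv.sum_comp]
  simp only [onedim_mul, Equiv.symm_apply_apply, mulMap]

theorem pairSum_add {d d' : ℕ} (p : Fin d → C(X, Set.Ioi (0 : ℝ)))
    (q : Fin d → C(Y, Set.Ioi (0 : ℝ))) (p' : Fin d' → C(X, Set.Ioi (0 : ℝ)))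
    (q' : Fin d' → C(Y, Set.Ioi (0 : ℝ))) :
    pairSum p q + pairSum p' q' = pairSum (Fin.append p p') (Fin.append q q') := by
  simp [pairSum, Fin.sum_univ_add]

theorem onedim_eq_pairSum (p : C(X, Set.Ioi (0 : ℝ))) (q : C(Y, Set.Ioi (0 : ℝ))) :
    onedim p q = pairSum (fun _ : Fin 1 => p) (fun _ => q) := by
  simp [pairSum]

/-- A multiplicative function on one-dimensional pairs whose sums are monotone extends to a
monotone semiring homomorphism. -/
theorem exists_orderRingHom {R : Type*} [CommSemiring R] [PartialOrder R]
    (g : C(X, Set.Ioi (0 : ℝ)) → C(Y, Set.Ioi (0 : ℝ)) → R)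
    (g_one : ∀ p q, (∀ x, (p x : ℝ) = 1) → (∀ y, (q y : ℝ) = 1) → g p q = 1)
    (g_mul : ∀ p p' P q q' Q, (∀ x, (P x : ℝ) = p x * p' x) → (∀ y, (Q y : ℝ) = q y * q' y) →
      g P Q = g p q * g p' q')
    (g_mono : ∀ (d d' : ℕ) (p : Fin d → C(X, Set.Ioi (0 : ℝ)))
      (q : Fin d → C(Y, Set.Ioi (0 : ℝ))) (p' : Fin d' → C(X, Set.Ioi (0 : ℝ)))
      (q' : Fin d' → C(Y, Set.Ioi (0 : ℝ))), pairSum p' q' ≤ pairSum p q →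
      ∑ j, g (p' j) (q' j) ≤ ∑ i, g (p i) (q i)) :
    ∃ f : ClassicalSemiring X Y →+*o R, ∀ (d : ℕ) (p : Fin d → C(X, Set.Ioi (0 : ℝ)))
      (q : Fin d → C(Y, Set.Ioi (0 : ℝ))), f (pairSum p q) = ∑ i, g (p i) (q i) := by
  choose D P Q hPQ using exists_eq_pairSum (X := X) (Y := Y)
  -- Two decompositions of the same element dominate each other, so `g_mono` in both directions and
  -- antisymmetry show independence of the chosen decomposition.
  have key : ∀ {d : ℕ} (p : Fin d → C(X, Set.Ioi (0 : ℝ))) (q : Fin d → C(Y, Set.Ioi (0 : ℝ))),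
      ∑ i, g (P (pairSum p q) i) (Q (pairSum p q) i) = ∑ i, g (p i) (q i) := fun p q =>
    le_antisymm (g_mono _ _ _ _ _ _ (hPQ (pairSum p q)).ge) (g_mono _ _ _ _ _ _ (hPQ _).le)
  have key' : ∀ s, ∀ {d : ℕ} (p : Fin d → C(X, Set.Ioi (0 : ℝ)))
      (q : Fin d → C(Y, Set.Ioi (0 : ℝ))), s = pairSum p q →
      ∑ i, g (P s i) (Q s i) = ∑ i, g (p i) (q i) := by
    rintro s d p q rfl; exact key p q
  refine ⟨{ toFun := fun s => ∑ i, g (P s i) (Q s i), map_one' := ?_, map_zero' := ?_,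
            map_add' := ?_, map_mul' := ?_, monotone' := ?_ }, fun d p q => key p q⟩
  · rw [key' 1 _ _ (onedim_one.symm.trans (onedim_eq_pairSum _ _))]
    simpa using g_one _ _ (fun _ => rfl) (fun _ => rfl)
  · intro s s'
    rw [key' (s * s') _ _ ((congrArg₂ (· * ·) (hPQ s) (hPQ s')).trans (pairSum_mul _ _ _ _)),
      Finset.sum_mul_sum, ← Finset.sum_product', Finset.univ_product_univ,
      ← finProdFinEquiv.sum_comp]
    simp only [Equiv.symm_apply_apply]
    exact Finset.sum_congr rfl fun k _ => g_mul _ _ _ _ _ _ (fun _ => rfl) (fun _ => rfl)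
  · rw [key' 0 Fin.elim0 Fin.elim0 (by simp [pairSum])]
    simp
  · intro s s'
    rw [key' (s + s') (Fin.append (P s) (P s')) (Fin.append (Q s) (Q s'))
      (by rw [← pairSum_add, ← hPQ, ← hPQ])]
    simp [Fin.sum_univ_add]
  · intro s s' h
    rw [hPQ s, hPQ s'] at h
    exact g_mono _ _ _ _ _ _ h

variable [CompactSpace Y] [MeasurableSpace Y] [BorelSpace Y]

/-- Each row of the substochastic matrix bounds one term of the smaller pair: superadditivity of the
geometric mean handles the second component, and joint convexity combines it with the first. Summing
over the rows, the column sums are at most `1`. -/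
theorem exists_real_point (α : ℝ) (hα : 1 ≤ α) (x : X) (γ : Measure Y) [IsProbabilityMeasure γ] :
    ∃ f : ClassicalSemiring X Y →+*o ℝ≥0, ∀ (d : ℕ) (p : Fin d → C(X, Set.Ioi (0 : ℝ)))
      (q : Fin d → C(Y, Set.Ioi (0 : ℝ))), (f (pairSum p q) : ℝ) =
        ∑ i, (p i x : ℝ) ^ α * geomMean γ (q i) ^ (1 - α) := by
  obtain ⟨g, hg⟩ : ∃ g : C(X, Set.Ioi (0 : ℝ)) → C(Y, Set.Ioi (0 : ℝ)) → ℝ≥0,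
      ∀ p q, (g p q : ℝ) = (p x : ℝ) ^ α * geomMean γ q ^ (1 - α) :=
    ⟨fun p q => ⟨(p x : ℝ) ^ α * geomMean γ q ^ (1 - α),
      mul_nonneg (Real.rpow_nonneg (p x).2.le _) (Real.rpow_nonneg (geomMean_pos γ q).le _)⟩,
      fun _ _ => rfl⟩
  have hmono : ∀ (d d' : ℕ) (p : Fin d → C(X, Set.Ioi (0 : ℝ)))
      (q : Fin d → C(Y, Set.Ioi (0 : ℝ))) (p' : Fin d' → C(X, Set.Ioi (0 : ℝ)))
      (q' : Fin d' → C(Y, Set.Ioi (0 : ℝ))), pairSum p' q' ≤ pairSum p q →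
      ∑ j, g (p' j) (q' j) ≤ ∑ i, g (p i) (q i) := by
    intro d d' p q p' q' h
    obtain ⟨t, t0, t1, hp, hq⟩ := exists_substochastic_of_le h
    rw [← NNReal.coe_le_coe, NNReal.coe_sum, NNReal.coe_sum]
    simp only [hg]
    calc ∑ j, (p' j x : ℝ) ^ α * geomMean γ (q' j) ^ (1 - α)
        ≤ ∑ j, ∑ i, t j i * ((p i x : ℝ) ^ α * geomMean γ (q i) ^ (1 - α)) :=
          Finset.sum_le_sum fun j _ => rpow_mul_rpow_le_sum hα (t0 j) (fun i => (p i x).2)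
            (fun i => geomMean_pos γ _) (p' j x).2 (hp x j)
            (sum_mul_geomMean_le γ (t0 j) fun y => hq y j)
      _ = ∑ i, (∑ j, t j i) * ((p i x : ℝ) ^ α * geomMean γ (q i) ^ (1 - α)) := by
          rw [Finset.sum_comm]
          simp only [Finset.sum_mul]
      _ ≤ _ := Finset.sum_le_sum fun i _ => mul_le_of_le_one_left
          (mul_nonneg (Real.rpow_nonneg (p i x).2.le _)
            (Real.rpow_nonneg (geomMean_pos γ _).le _)) (t1 i)
  obtain ⟨f, hf⟩ := exists_orderRingHom g
    (fun p q hp hq => NNReal.eq <| by simp [hg, hp, geomMean_one γ hq])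
    (fun p p' P q q' Q hp hq => NNReal.eq <| by
      rw [NNReal.coe_mul, hg, hg, hg, hp, geomMean_mul γ hq, Real.mul_rpow (p x).2.le (p' x).2.le,
        Real.mul_rpow (geomMean_pos γ q).le (geomMean_pos γ q').le]
      ring)
    hmono
  exact ⟨f, fun d p q => by rw [hf, NNReal.coe_sum]; simp only [hg]⟩

/-- A bound `p ≤ M * geomMean γ q` on all components survives nonnegative combinations, since the
left side is additive and the geometric mean is superadditive. The best such `M ≥ 0` is the value of
the formula. -/
theorem exists_tropical_point (x : X) (γ : Measure Y) [IsProbabilityMeasure γ] :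
    ∃ f : ClassicalSemiring X Y →+*o TropicalReal, ∀ (d : ℕ) (p : Fin d → C(X, Set.Ioi (0 : ℝ)))
      (q : Fin d → C(Y, Set.Ioi (0 : ℝ))), ((f (pairSum p q)).val : ℝ) =
        ⨆ i, (p i x : ℝ) * (geomMean γ (q i))⁻¹ := by
  obtain ⟨g, hg⟩ : ∃ g : C(X, Set.Ioi (0 : ℝ)) → C(Y, Set.Ioi (0 : ℝ)) → TropicalReal,
      ∀ p q, ((g p q).val : ℝ) = (p x : ℝ) * (geomMean γ q)⁻¹ :=
    ⟨fun p q => ⟨⟨(p x : ℝ) * (geomMean γ q)⁻¹,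
      mul_nonneg (p x).2.le (inv_nonneg.2 (geomMean_pos γ q).le)⟩⟩, fun _ _ => rfl⟩
  have hmono : ∀ (d d' : ℕ) (p : Fin d → C(X, Set.Ioi (0 : ℝ)))
      (q : Fin d → C(Y, Set.Ioi (0 : ℝ))) (p' : Fin d' → C(X, Set.Ioi (0 : ℝ)))
      (q' : Fin d' → C(Y, Set.Ioi (0 : ℝ))), pairSum p' q' ≤ pairSum p q →
      ∑ j, g (p' j) (q' j) ≤ ∑ i, g (p i) (q i) := by
    intro d d' p q p' q' h
    obtain ⟨t, t0, -, hp, hq⟩ := exists_substochastic_of_le h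
    rw [TropicalReal.le_def, ← NNReal.coe_le_coe, TropicalReal.val_sum, TropicalReal.val_sum]
    simp only [hg]
    have h0 : ∀ i, 0 ≤ (p i x : ℝ) * (geomMean γ (q i))⁻¹ := fun i =>
      mul_nonneg (p i x).2.le (inv_nonneg.2 (geomMean_pos γ _).le)
    refine Real.iSup_le (fun j => ?_) (Real.iSup_nonneg h0)
    set M := ⨆ i, (p i x : ℝ) * (geomMean γ (q i))⁻¹
    have hM : ∀ i, (p i x : ℝ) ≤ M * geomMean γ (q i) := fun i => by
      rw [← div_le_iff₀ (geomMean_pos γ _), div_eq_mul_inv]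
      exact le_ciSup (f := fun i => (p i x : ℝ) * (geomMean γ (q i))⁻¹) (Set.finite_range _).bddAbove i
    rw [← div_eq_mul_inv, div_le_iff₀ (geomMean_pos γ _)]
    calc (p' j x : ℝ) ≤ ∑ i, t j i * p i x := hp x j
      _ ≤ ∑ i, t j i * (M * geomMean γ (q i)) :=
          Finset.sum_le_sum fun i _ => mul_le_mul_of_nonneg_left (hM i) (t0 j i)
      _ = M * ∑ i, t j i * geomMean γ (q i) := by
          rw [Finset.mul_sum]
          exact Finset.sum_congr rfl fun i _ => mul_left_comm _ _ _
      _ ≤ _ := mul_le_mul_of_nonneg_left (sum_mul_geomMean_le γ (t0 j) fun y => hq y j)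
          (Real.iSup_nonneg h0)
  obtain ⟨f, hf⟩ := exists_orderRingHom g
    (fun p q hp hq => TropicalReal.ext <| NNReal.eq <| by simp [hg, hp, geomMean_one γ hq])
    (fun p p' P q q' Q hp hq => TropicalReal.ext <| NNReal.eq <| by
      rw [TropicalReal.mul_val, NNReal.coe_mul, hg, hg, hg, hp, geomMean_mul γ hq, mul_inv]
      ring)
    hmono
  exact ⟨f, fun d p q => by rw [hf, TropicalReal.val_sum]; simp only [hg]⟩

end Construction

end Families

namespace Families

open MeasureTheory

/-! ### Monotone additive functionals on continuous functions -/

section Functionals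

variable {X : Type*} [TopologicalSpace X]

/-- A monotone additive map `ℝ → ℝ` is measurable, hence continuous, hence linear. -/
theorem map_const_of_monotone {A : C(X, ℝ) →+ ℝ} (hA : Monotone A) (c : ℝ) :
    A (ContinuousMap.const X c) = c * A (ContinuousMap.const X 1) := by
  let φ : ℝ →+ ℝ :=
    AddMonoidHom.mk' (fun c => A (ContinuousMap.const X c)) fun a b => by
      rw [← map_add]; rfl
  have hφ : Monotone φ := fun a b hab => hA fun _ => hab
  have := map_real_smul φ (Measure.AddMonoidHom.continuous_of_measurable φ hφ.measurable) c 1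
  simpa [φ] using this

theorem abs_le_norm_of_monotone [CompactSpace X] {A : C(X, ℝ) →+ ℝ} (hA : Monotone A)
    (g : C(X, ℝ)) : |A g| ≤ ‖g‖ * A (ContinuousMap.const X 1) := by
  rw [← map_const_of_monotone hA, abs_le, ← map_neg]
  exact ⟨hA fun x => (abs_le.1 (g.norm_coe_le_norm x)).1,
    hA fun x => (abs_le.1 (g.norm_coe_le_norm x)).2⟩

/-- A normalized monotone additive functional on `C(X, ℝ)` is the integral against a regular
probability measure. -/
theorem exists_integral_eq [CompactSpace X] [T2Space X] [MeasurableSpace X] [BorelSpace X]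
    {A : C(X, ℝ) →+ ℝ} (hA : Monotone A) (h1 : A (ContinuousMap.const X 1) = 1) :
    ∃ γ : ProbabilityMeasure X, (γ : Measure X).Regular ∧
      ∀ g : C(X, ℝ), A g = ∫ x, g x ∂(γ : Measure X) := by
  -- Continuity upgrades additivity to real homogeneity, which the Riesz–Markov–Kakutani theorem
  -- requires.
  have hcont : Continuous A := AddMonoidHomClass.continuous_of_bound A 1 fun g => by
    rw [Real.norm_eq_abs]
    simpa only [h1, mul_one, one_mul] using abs_le_norm_of_monotone hA g
  let Λ : CompactlySupportedContinuousMap X ℝ →ₚ[ℝ] ℝ :=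
    { toFun := fun g => A g.toContinuousMap
      map_add' := fun g g' => map_add A g.toContinuousMap g'.toContinuousMap
      map_smul' := fun c g => map_real_smul A hcont c g.toContinuousMap
      monotone' := fun g g' h => hA h }
  have hΛ : ∀ g : C(X, ℝ), A g = ∫ x, g x ∂(RealRMK.rieszMeasure Λ) := fun g =>
    (RealRMK.integral_rieszMeasure Λ ⟨g, HasCompactSupport.of_compactSpace _⟩).symm
  have hprob : IsProbabilityMeasure (RealRMK.rieszMeasure Λ) := by
    have := hΛ (ContinuousMap.const X 1)
    rw [h1] at this
    simp only [ContinuousMap.const_apply, integral_const, smul_eq_mul, mul_one] at this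
    exact ⟨by rw [← ENNReal.toReal_eq_one_iff]; exact this.symm⟩
  exact ⟨⟨_, hprob⟩, RealRMK.regular_rieszMeasure Λ, hΛ⟩

/-- The two-term inequality iterates because a sum of exponentials is itself the exponential of a
continuous function, the `g'` below. -/
theorem exp_le_sum_of_subadditive {N : C(X, ℝ) → ℝ}
    (hN : ∀ g g₁ g₂ : C(X, ℝ), (∀ x, Real.exp (g x) ≤ Real.exp (g₁ x) + Real.exp (g₂ x)) →
      Real.exp (N g) ≤ Real.exp (N g₁) + Real.exp (N g₂))
    (hmono : Monotone N) {ι : Type*} {s : Finset ι} (hs : s.Nonempty) (G : ι → C(X, ℝ))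
    (g : C(X, ℝ)) (h : ∀ x, Real.exp (g x) ≤ ∑ i ∈ s, Real.exp (G i x)) :
    Real.exp (N g) ≤ ∑ i ∈ s, Real.exp (N (G i)) := by
  induction hs using Finset.Nonempty.cons_induction generalizing g with
  | singleton a =>
    simp only [Finset.sum_singleton, Real.exp_le_exp] at h ⊢
    exact hmono h
  | cons a s ha hs ih =>
    have hpos : ∀ x, 0 < ∑ i ∈ s, Real.exp (G i x) := fun x =>
      Finset.sum_pos (fun i _ => Real.exp_pos _) hs
    let g' : C(X, ℝ) := ⟨fun x => Real.log (∑ i ∈ s, Real.exp (G i x)),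
      Continuous.log (by fun_prop) fun x => (hpos x).ne'⟩
    have hg' : ∀ x, Real.exp (g' x) = ∑ i ∈ s, Real.exp (G i x) := fun x => Real.exp_log (hpos x)
    rw [Finset.sum_cons]
    refine (hN g (G a) g' fun x => ?_).trans (by gcongr; exact ih g' fun x => (hg' x).le)
    rw [hg']
    simpa only [Finset.sum_cons] using h x

/-- A normalized monotone additive functional `A` such that `exp ∘ A ∘ log` is subadditive is the
evaluation at a point. -/
theorem exists_eval_eq [CompactSpace X] [Nonempty X] {A : C(X, ℝ) →+ ℝ} (hA : Monotone A)
    (h1 : A (ContinuousMap.const X 1) = 1)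
    (hsub : ∀ g g₁ g₂ : C(X, ℝ), (∀ x, Real.exp (g x) ≤ Real.exp (g₁ x) + Real.exp (g₂ x)) →
      Real.exp (A g) ≤ Real.exp (A g₁) + Real.exp (A g₂)) :
    ∃ x, ∀ g, A g = g x := by
  have hconst : ∀ c, A (ContinuousMap.const X c) = c := fun c => by
    rw [map_const_of_monotone hA, h1, mul_one]
  by_contra! hne
  -- If `A` is not evaluation at `x`, some `g`, up to sign, has `A g < g x`. Subtracting the
  -- constant `A g` and multiplying by a large integer normalizes it.
  have hG : ∀ x, ∃ g : C(X, ℝ), A g = 0 ∧ 1 < g x := by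
    intro x
    obtain ⟨g, hg⟩ := hne x
    obtain ⟨g, hg⟩ : ∃ g : C(X, ℝ), A g < g x := by
      rcases hg.lt_or_gt with h | h
      · exact ⟨g, h⟩
      · exact ⟨-g, by rw [map_neg]; simpa using h⟩
    obtain ⟨n, hn⟩ := exists_nat_gt (1 / (g x - A g))
    rw [div_lt_iff₀ (sub_pos.2 hg)] at hn
    refine ⟨n • (g - ContinuousMap.const X (A g)), ?_, ?_⟩
    · rw [map_nsmul, map_sub, hconst, sub_self, smul_zero]
    · simpa using hn
  choose G hG0 hG1 using hG
  obtain ⟨s, hs⟩ := CompactSpace.elim_nhds_subcover (fun x => {y | 1 < G x y}) fun x =>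
    (isOpen_lt continuous_const (G x).continuous).mem_nhds (hG1 x)
  have hcov : ∀ y, ∃ x ∈ s, 1 < G x y := fun y => by
    have : y ∈ ⋃ x ∈ s, {y | 1 < G x y} := hs ▸ Set.mem_univ y
    simpa using this
  have hne : s.Nonempty := by
    obtain ⟨x, hx, -⟩ := hcov (Classical.arbitrary X)
    exact ⟨x, hx⟩
  -- Finitely many `G x` exceed `1` somewhere at every point, so `exp n` is at most the sum of the
  -- `exp (n • G x)`. Subadditivity and `A (G x) = 0` turn this into a bound independent of `n`,
  -- which is absurd.
  have key : ∀ n : ℕ, Real.exp n ≤ s.card := fun n => by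
    have := exp_le_sum_of_subadditive (N := A) hsub hA hne (fun x => n • G x)
      (ContinuousMap.const X (n : ℝ)) fun y => by
        obtain ⟨x, hx, hxy⟩ := hcov y
        refine le_trans ?_ (Finset.single_le_sum (fun i _ => (Real.exp_pos _).le) hx)
        simpa using le_mul_of_one_le_right (Nat.cast_nonneg n) hxy.le
    simpa only [hconst, map_nsmul, hG0, smul_zero, Real.exp_zero, Finset.sum_const, nsmul_one]
      using this
  have := key s.card
  linarith [Real.add_one_le_exp (s.card : ℝ)]

end Functionals

/-! ### Classification of the real and tropical homomorphisms -/

section Characters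

variable {X Y : Type*} [TopologicalSpace X] [TopologicalSpace Y]

/-- The exponential of a continuous function. -/
def expMap (g : C(X, ℝ)) : C(X, Set.Ioi (0 : ℝ)) :=
  ⟨fun x => ⟨Real.exp (g x), Real.exp_pos _⟩, Continuous.subtype_mk (by fun_prop) _⟩

/-- The logarithm of a strictly positive continuous function. -/
def logMap (p : C(X, Set.Ioi (0 : ℝ))) : C(X, ℝ) :=
  ⟨fun x => Real.log (p x), Continuous.log (by fun_prop) fun x => (p x).2.ne'⟩

@[simp] theorem expMap_apply (g : C(X, ℝ)) (x : X) : (expMap g x : ℝ) = Real.exp (g x) := rfl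

@[simp] theorem logMap_apply (p : C(X, Set.Ioi (0 : ℝ))) (x : X) :
    logMap p x = Real.log (p x) := rfl

@[simp] theorem expMap_logMap (p : C(X, Set.Ioi (0 : ℝ))) : expMap (logMap p) = p :=
  ContinuousMap.ext fun x => Subtype.ext (Real.exp_log (p x).2)

/-- The logarithm of a multiplicative monotone positive function on one-dimensional pairs is a
difference of monotone additive functionals. -/
theorem exists_log_additive {F : C(X, Set.Ioi (0 : ℝ)) → C(Y, Set.Ioi (0 : ℝ)) → ℝ}
    (pos : ∀ p q, 0 < F p q)
    (mul : ∀ p p' q q', F (mulMap p p') (mulMap q q') = F p q * F p' q')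
    (mono : ∀ p p' q q', (∀ x, (p x : ℝ) ≤ p' x) → (∀ y, (q' y : ℝ) ≤ q y) → F p q ≤ F p' q') :
    ∃ (A : C(X, ℝ) →+ ℝ) (B : C(Y, ℝ) →+ ℝ), Monotone A ∧ Monotone B ∧
      ∀ g h, F (expMap g) (expMap h) = Real.exp (A g - B h) := by
  have hadd : ∀ g g' h h', F (expMap (g + g')) (expMap (h + h')) =
      F (expMap g) (expMap h) * F (expMap g') (expMap h') := fun g g' h h' => by
    rw [← mul]
    congr 1 <;> ext <;> simp [mulMap, Real.exp_add]
  let A : C(X, ℝ) →+ ℝ := AddMonoidHom.mk' (fun g => Real.log (F (expMap g) (expMap 0)))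
    fun g g' => by
      rw [← Real.log_mul (pos _ _).ne' (pos _ _).ne', ← hadd, add_zero]
  let B : C(Y, ℝ) →+ ℝ := AddMonoidHom.mk' (fun h => -Real.log (F (expMap 0) (expMap h)))
    fun h h' => by
      rw [← neg_add, ← Real.log_mul (pos _ _).ne' (pos _ _).ne', ← hadd, add_zero]
  refine ⟨A, B, fun g g' hg => ?_, fun h h' hh => ?_, fun g h => ?_⟩
  · exact Real.log_le_log (pos _ _) (mono _ _ _ _ (fun x => Real.exp_le_exp.2 (hg x))
      fun _ => le_rfl)
  · exact neg_le_neg (Real.log_le_log (pos _ _) (mono _ _ _ _ (fun _ => le_rfl)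
      fun y => Real.exp_le_exp.2 (hh y)))
  · change _ = Real.exp (Real.log _ - -Real.log _)
    rw [sub_neg_eq_add, Real.exp_add, Real.exp_log (pos _ _), Real.exp_log (pos _ _), ← hadd,
      add_zero, zero_add]

/-- The inverse is given by pointwise reciprocals. Homomorphisms therefore do not vanish on
one-dimensional pairs, and their logarithm makes sense. -/
theorem onedim_isUnit (p : C(X, Set.Ioi (0 : ℝ))) (q : C(Y, Set.Ioi (0 : ℝ))) :
    IsUnit (onedim p q) := by
  refine IsUnit.of_mul_eq_one (onedim (expMap (-logMap p)) (expMap (-logMap q))) ?_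
  rw [onedim_mul, ← onedim_one]
  congr 1 <;> ext z
  · simp [Real.exp_neg, Real.exp_log (p z).2, ne_of_gt (Set.mem_Ioi.1 (p z).2)]
  · simp [Real.exp_neg, Real.exp_log (q z).2, ne_of_gt (Set.mem_Ioi.1 (q z).2)]

variable (X Y) in
/-- The one-dimensional pair of constant functions `1 / 2`. -/
def half : ClassicalSemiring X Y :=
  onedim (expMap (ContinuousMap.const X (-Real.log 2)))
    (expMap (ContinuousMap.const Y (-Real.log 2)))

/-- Splitting evenly and merging are both allowed operations. Homomorphisms into a partially ordered
target thus identify the two elements, which ties `A 1` to `B 1`. -/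
theorem half_add_half : half X Y + half X Y ≤ 1 ∧ 1 ≤ half X Y + half X Y := by
  have h2 : Real.exp (-Real.log 2) = 1 / 2 := by
    rw [Real.exp_neg, Real.exp_log two_pos, one_div]
  rw [← onedim_one]
  constructor
  · refine half_add_half_le ?_ ?_ <;> intro z <;> simp [h2]
  · refine onedim_le_add ?_ ?_ <;> intro z <;> simp [h2] <;> norm_num

variable [CompactSpace X] [Nonempty X] [CompactSpace Y] [T2Space Y] [Nonempty Y]
  [MeasurableSpace Y] [BorelSpace Y]

theorem exists_eval_integral {A : C(X, ℝ) →+ ℝ} {B : C(Y, ℝ) →+ ℝ} (hA : Monotone A)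
    (hB : Monotone B) (hpos : 0 < A (ContinuousMap.const X 1))
    (hsub : ∀ g g₁ g₂ : C(X, ℝ), (∀ x, Real.exp (g x) ≤ Real.exp (g₁ x) + Real.exp (g₂ x)) →
      Real.exp (A g / A (ContinuousMap.const X 1)) ≤
        Real.exp (A g₁ / A (ContinuousMap.const X 1)) +
          Real.exp (A g₂ / A (ContinuousMap.const X 1))) :
    ∃ (x : X) (γ : ProbabilityMeasure Y), (γ : Measure Y).Regular ∧
      (∀ g, A g = A (ContinuousMap.const X 1) * g x) ∧
      ∀ h : C(Y, ℝ), B h = B (ContinuousMap.const Y 1) * ∫ y, h y ∂(γ : Measure Y) := by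
  obtain ⟨α, hα⟩ : ∃ α, α = A (ContinuousMap.const X 1) := ⟨_, rfl⟩
  obtain ⟨β, hβ⟩ : ∃ β, β = B (ContinuousMap.const Y 1) := ⟨_, rfl⟩
  rw [← hα, ← hβ]
  rw [← hα] at hsub hpos
  obtain ⟨x, hx⟩ := exists_eval_eq (A := (AddMonoidHom.mulLeft α⁻¹).comp A)
    (fun g g' h => mul_le_mul_of_nonneg_left (hA h) (inv_nonneg.2 hpos.le))
    (by change α⁻¹ * A _ = 1; rw [← hα, inv_mul_cancel₀ hpos.ne'])
    (fun g g₁ g₂ h => by simpa [div_eq_inv_mul] using hsub g g₁ g₂ h)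
  have hx' : ∀ g, A g = α * g x := fun g => by
    rw [← hx g]; simp [hpos.ne']
  have hβ0 : 0 ≤ β := by
    rw [hβ, ← map_zero B]
    exact hB fun _ => zero_le_one
  rcases hβ0.eq_or_lt with h0 | h0
  -- For `β = 0` the functional `B` vanishes, so any regular probability measure serves; evaluation
  -- at an arbitrary point supplies one.
  · obtain ⟨γ, hγ, -⟩ := exists_integral_eq (X := Y)
      (A := AddMonoidHom.mk' (fun g : C(Y, ℝ) => g (Classical.arbitrary Y)) fun _ _ => rfl)
      (fun g g' h => h _) rfl
    refine ⟨x, γ, hγ, hx', fun h => ?_⟩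
    have := abs_le_norm_of_monotone hB h
    rw [← hβ, ← h0, mul_zero] at this
    rw [← h0, zero_mul]
    exact abs_nonpos_iff.1 this
  · obtain ⟨γ, hγ, hint⟩ := exists_integral_eq (A := (AddMonoidHom.mulLeft β⁻¹).comp B)
      (fun g g' h => mul_le_mul_of_nonneg_left (hB h) (inv_nonneg.2 hβ0))
      (by change β⁻¹ * B _ = 1; rw [← hβ, inv_mul_cancel₀ h0.ne'])
    refine ⟨x, γ, hγ, hx', fun h => ?_⟩
    rw [← hint h]; simp [h0.ne']

theorem real_point_eq (f : ClassicalSemiring X Y →+*o ℝ≥0) :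
    ∃ (α : ℝ) (x : X) (γ : ProbabilityMeasure Y), 1 ≤ α ∧ (γ : Measure Y).Regular ∧
      ∀ (p : C(X, Set.Ioi (0 : ℝ))) (q : C(Y, Set.Ioi (0 : ℝ))), (f (onedim p q) : ℝ) =
        (p x : ℝ) ^ α * Real.exp ((1 - α) * ∫ y, Real.log (q y : ℝ) ∂(γ : Measure Y)) := by
  obtain ⟨A, B, hA, hB, hAB⟩ := exists_log_additive (F := fun p q => (f (onedim p q) : ℝ))
    (fun p q => NNReal.coe_pos.2 (pos_iff_ne_zero.2 ((onedim_isUnit p q).map f).ne_zero))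
    (fun p p' q q' => by rw [← NNReal.coe_mul, ← map_mul, onedim_mul]; rfl)
    (fun p p' q q' hp hq => NNReal.coe_le_coe.2 (OrderHomClass.mono f (onedim_mono hp hq)))
  obtain ⟨α, hα⟩ : ∃ α, α = A (ContinuousMap.const X 1) := ⟨_, rfl⟩
  obtain ⟨β, hβ⟩ : ∃ β, β = B (ContinuousMap.const Y 1) := ⟨_, rfl⟩
  have hAc : ∀ c, A (ContinuousMap.const X c) = c * α := fun c => by
    rw [map_const_of_monotone hA, hα]
  have hBc : ∀ c, B (ContinuousMap.const Y c) = c * β := fun c => by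
    rw [map_const_of_monotone hB, hβ]
  have hβ0 : 0 ≤ β := by
    rw [hβ, ← map_zero B]
    exact hB fun _ => zero_le_one
  -- Applied to `half + half`, `f` gives `2 * 2 ^ (β - α) = 1`.
  have hαβ : α = 1 + β := by
    have h := le_antisymm (OrderHomClass.mono f (half_add_half (X := X) (Y := Y)).1)
      (OrderHomClass.mono f half_add_half.2)
    rw [map_add, map_one, ← NNReal.coe_inj, NNReal.coe_add, half, hAB, hAc, hBc, NNReal.coe_one] at h
    have h' : Real.exp (-Real.log 2 * α - -Real.log 2 * β) = 2⁻¹ := by linarith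
    rw [← Real.exp_log (x := 2⁻¹) (by norm_num), Real.exp_eq_exp, Real.log_inv] at h'
    have := Real.log_pos one_lt_two
    have h3 : Real.log 2 * (α - (1 + β)) = 0 := by linarith
    rcases mul_eq_zero.1 h3 with h4 | h4 <;> linarith
  have hα0 : 0 < α := by linarith
  obtain ⟨x, γ, hγ, hx, hy⟩ := exists_eval_integral hA hB (hα ▸ hα0) (by
    rw [← hα]
    intro g g₁ g₂ hg
    -- The constants `exp a₁`, `exp a₂` for the second components are chosen so that the two
    -- summands have values `exp a₁`, `exp a₂`, because `α - β = 1`. With their sum `exp s` as the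
    -- merged second component, monotonicity reads `A g - s * β ≤ s`, that is, `A g / α ≤ s`.
    set a₁ := A g₁ / α with ha₁
    set a₂ := A g₂ / α with ha₂
    have hs := Real.exp_log (add_pos (Real.exp_pos a₁) (Real.exp_pos a₂))
    set s := Real.log (Real.exp a₁ + Real.exp a₂)
    have h := NNReal.coe_le_coe.2 (OrderHomClass.mono f (onedim_le_add (p := expMap g)
      (p₁ := expMap g₁) (p₂ := expMap g₂) (q := expMap (ContinuousMap.const Y s))
      (q₁ := expMap (ContinuousMap.const Y a₁)) (q₂ := expMap (ContinuousMap.const Y a₂))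
      hg (fun _ => hs.ge)))
    rw [map_add, NNReal.coe_add, hAB, hAB, hAB, hBc, hBc, hBc] at h
    have e₁ : A g₁ - a₁ * β = a₁ := by
      have : A g₁ = a₁ * α := by rw [ha₁]; field_simp
      rw [this, hαβ]; ring
    have e₂ : A g₂ - a₂ * β = a₂ := by
      have : A g₂ = a₂ * α := by rw [ha₂]; field_simp
      rw [this, hαβ]; ring
    rw [e₁, e₂, ← hs, Real.exp_le_exp] at h
    rw [← hs, Real.exp_le_exp, div_le_iff₀ hα0, hαβ]
    linarith)
  rw [← hα] at hx
  rw [← hβ] at hy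
  refine ⟨α, x, γ, by linarith, hγ, fun p q => ?_⟩
  have := hAB (logMap p) (logMap q)
  rw [expMap_logMap, expMap_logMap, hx, hy, sub_eq_add_neg, Real.exp_add] at this
  rw [this, Real.rpow_def_of_pos (p x).2, hαβ]
  congr 2
  · simp [mul_comm]
  · simp

theorem tropical_point_eq (f : ClassicalSemiring X Y →+*o TropicalReal)
    (hf : (f (powerUniversal X Y)).val = 2) :
    ∃ (x : X) (γ : ProbabilityMeasure Y), (γ : Measure Y).Regular ∧
      ∀ (p : C(X, Set.Ioi (0 : ℝ))) (q : C(Y, Set.Ioi (0 : ℝ))), ((f (onedim p q)).val : ℝ) =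
        (p x : ℝ) * Real.exp (-∫ y, Real.log (q y : ℝ) ∂(γ : Measure Y)) := by
  obtain ⟨A, B, hA, hB, hAB⟩ := exists_log_additive (F := fun p q => ((f (onedim p q)).val : ℝ))
    (fun p q => NNReal.coe_pos.2 (pos_iff_ne_zero.2 fun h0 => by
      obtain ⟨t, ht⟩ := (onedim_isUnit p q).exists_right_inv
      have := congrArg TropicalReal.val (congrArg f ht)
      rw [map_mul, TropicalReal.mul_val, h0, zero_mul, map_one] at this
      exact zero_ne_one this))
    (fun p p' q q' => by
      rw [← NNReal.coe_mul, ← TropicalReal.mul_val, ← map_mul, onedim_mul]; rfl)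
    (fun p p' q q' hp hq => NNReal.coe_le_coe.2 (OrderHomClass.mono f (onedim_mono hp hq)))
  obtain ⟨α, hα⟩ : ∃ α, α = A (ContinuousMap.const X 1) := ⟨_, rfl⟩
  obtain ⟨β, hβ⟩ : ∃ β, β = B (ContinuousMap.const Y 1) := ⟨_, rfl⟩
  have hAc : ∀ c, A (ContinuousMap.const X c) = c * α := fun c => by
    rw [map_const_of_monotone hA, hα]
  have hBc : ∀ c, B (ContinuousMap.const Y c) = c * β := fun c => by
    rw [map_const_of_monotone hB, hβ]
  have hlog := Real.log_pos one_lt_two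
  -- The normalization `f u = 2` says `2 ^ α = 2`.
  have hα1 : α = 1 := by
    have hu : powerUniversal X Y = onedim (expMap (ContinuousMap.const X (Real.log 2)))
        (expMap (ContinuousMap.const Y 0)) := by
      rw [powerUniversal]
      congr 1 <;> ext z
      · simp [Real.exp_log]
      · simp
    have := hAB (ContinuousMap.const X (Real.log 2)) (ContinuousMap.const Y 0)
    rw [← hu, hf, hAc, hBc, zero_mul, sub_zero] at this
    have h2 : Real.log 2 = Real.log 2 * α := by
      rw [← Real.log_exp (Real.log 2 * α), ← this]; rfl
    exact mul_left_cancel₀ hlog.ne' (by linarith)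
  -- Tropical addition is idempotent, so `half` itself has value `1`, that is, `2 ^ (β - α) = 1`.
  have hβ1 : β = 1 := by
    have h := le_antisymm (OrderHomClass.mono f (half_add_half (X := X) (Y := Y)).1)
      (OrderHomClass.mono f half_add_half.2)
    have h := congrArg (fun t => (t.val : ℝ)) h
    simp only [map_add, map_one, TropicalReal.add_val, max_self, TropicalReal.one_val, half, hAB, hAc,
      hBc, NNReal.coe_one, Real.exp_eq_one_iff] at h
    have : Real.log 2 * (α - β) = 0 := by linarith
    rcases mul_eq_zero.1 this with h4 | h4 <;> linarith
  obtain ⟨x, γ, hγ, hx, hy⟩ := exists_eval_integral hA hB (by rw [← hα, hα1]; exact one_pos) (by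
    rw [← hα, hα1]
    intro g g₁ g₂ hg
    simp only [div_one]
    -- With `exp (A g₁)` and `exp (A g₂)` as second components both summands have value `1`, hence
    -- so does their tropical sum, and monotonicity gives `A g ≤ s`.
    have hs := Real.exp_log (add_pos (Real.exp_pos (A g₁)) (Real.exp_pos (A g₂)))
    set s := Real.log (Real.exp (A g₁) + Real.exp (A g₂))
    have h := NNReal.coe_le_coe.2 (TropicalReal.le_def.1 (OrderHomClass.mono f (onedim_le_add
      (p := expMap g) (p₁ := expMap g₁) (p₂ := expMap g₂)
      (q := expMap (ContinuousMap.const Y s)) (q₁ := expMap (ContinuousMap.const Y (A g₁)))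
      (q₂ := expMap (ContinuousMap.const Y (A g₂))) hg (fun _ => hs.ge))))
    rw [map_add, TropicalReal.add_val, NNReal.coe_max, hAB, hAB, hAB, hBc, hBc, hBc, hβ1, mul_one,
      mul_one, mul_one, sub_self, sub_self, max_self, Real.exp_le_exp] at h
    rw [← hs, Real.exp_le_exp]
    linarith)
  rw [← hα, hα1] at hx
  rw [← hβ, hβ1] at hy
  refine ⟨x, γ, hγ, fun p q => ?_⟩
  have := hAB (logMap p) (logMap q)
  rw [expMap_logMap, expMap_logMap, hx, hy, sub_eq_add_neg, Real.exp_add, one_mul, one_mul,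
    logMap_apply, Real.exp_log (p x).2] at this
  exact this

end Characters

end Families

end

/-! ### Determination of the spectrum -/

theorem theorem3 {X : Type*} {Y : Type*}
    [TopologicalSpace X] [CompactSpace X] [T2Space X] [Nonempty X]
    [TopologicalSpace Y] [CompactSpace Y] [T2Space Y] [Nonempty Y]
    [MeasurableSpace Y] [BorelSpace Y] :
    (∀ (α : ℝ) (x : X) (γ : MeasureTheory.ProbabilityMeasure Y), 1 ≤ α →
      ∃! F : TSper₁ (Families.ClassicalSemiring X Y) (Families.powerUniversal X Y),
        ∃ f, F = Sum.inl f ∧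
          ∀ (d : ℕ) (p : Fin d → C(X, Set.Ioi (0 : ℝ))) (q : Fin d → C(Y, Set.Ioi (0 : ℝ))),
            (f (Families.pairSum p q) : ℝ) =
              ∑ i, (p i x : ℝ) ^ α *
                Real.exp ((1 - α) * ∫ y, Real.log (q i y : ℝ) ∂(γ : MeasureTheory.Measure Y))) ∧
    (∀ (x : X) (γ : MeasureTheory.ProbabilityMeasure Y),
      ∃! F : TSper₁ (Families.ClassicalSemiring X Y) (Families.powerUniversal X Y),
        ∃ f, F = Sum.inr f ∧
          ∀ (d : ℕ) (p : Fin d → C(X, Set.Ioi (0 : ℝ))) (q : Fin d → C(Y, Set.Ioi (0 : ℝ))),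
            ((f.1 (Families.pairSum p q)).val : ℝ) =
              ⨆ i, (p i x : ℝ) *
                Real.exp (-∫ y, Real.log (q i y : ℝ) ∂(γ : MeasureTheory.Measure Y))) ∧
    (∀ F : TSper₁ (Families.ClassicalSemiring X Y) (Families.powerUniversal X Y),
      (∃ f, F = Sum.inl f ∧
        ∃ (α : ℝ) (x : X) (γ : MeasureTheory.ProbabilityMeasure Y),
          1 ≤ α ∧ (γ : MeasureTheory.Measure Y).Regular ∧
          ∀ (d : ℕ) (p : Fin d → C(X, Set.Ioi (0 : ℝ))) (q : Fin d → C(Y, Set.Ioi (0 : ℝ))),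
            (f (Families.pairSum p q) : ℝ) =
              ∑ i, (p i x : ℝ) ^ α *
                Real.exp ((1 - α) * ∫ y, Real.log (q i y : ℝ) ∂(γ : MeasureTheory.Measure Y))) ∨
      (∃ f, F = Sum.inr f ∧
        ∃ (x : X) (γ : MeasureTheory.ProbabilityMeasure Y),
          (γ : MeasureTheory.Measure Y).Regular ∧
          ∀ (d : ℕ) (p : Fin d → C(X, Set.Ioi (0 : ℝ))) (q : Fin d → C(Y, Set.Ioi (0 : ℝ))),
            ((f.1 (Families.pairSum p q)).val : ℝ) =
              ⨆ i, (p i x : ℝ) *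
                Real.exp (-∫ y, Real.log (q i y : ℝ) ∂(γ : MeasureTheory.Measure Y)))) := by
  have hexp : ∀ (α : ℝ) (γ : MeasureTheory.Measure Y) (q : C(Y, Set.Ioi (0 : ℝ))),
      Families.geomMean γ q ^ (1 - α) =
        Real.exp ((1 - α) * ∫ y, Real.log (q y : ℝ) ∂γ) := fun α γ q => by
    rw [Families.geomMean, ← Real.exp_mul, mul_comm]
  refine ⟨fun α x γ hα => ?_, fun x γ => ?_, fun F => ?_⟩
  · obtain ⟨f, hf⟩ := Families.exists_real_point (X := X) α hα x (γ : MeasureTheory.Measure Y)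
    simp only [hexp] at hf
    refine ⟨Sum.inl f, ⟨f, rfl, hf⟩, ?_⟩
    rintro _ ⟨f', rfl, hf'⟩
    congr 1
    -- Uniqueness: sums of one-dimensional pairs exhaust the semiring, so the formula determines the
    -- homomorphism.
    refine DFunLike.ext _ _ fun s => ?_
    obtain ⟨d, p, q, rfl⟩ := Families.exists_eq_pairSum s
    exact NNReal.eq ((hf' d p q).trans (hf d p q).symm)
  · obtain ⟨f, hf⟩ := Families.exists_tropical_point x (γ : MeasureTheory.Measure Y)
    simp only [Families.geomMean, ← Real.exp_neg] at hf
    have hu : (f (Families.powerUniversal X Y)).val = 2 := by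
      refine NNReal.eq ?_
      rw [Families.powerUniversal, Families.onedim_eq_pairSum, hf]
      simp
    refine ⟨Sum.inr ⟨f, hu⟩, ⟨⟨f, hu⟩, rfl, hf⟩, ?_⟩
    rintro _ ⟨f', rfl, hf'⟩
    congr 1
    refine Subtype.ext (DFunLike.ext _ _ fun s => ?_)
    obtain ⟨d, p, q, rfl⟩ := Families.exists_eq_pairSum s
    exact TropicalReal.ext (NNReal.eq ((hf' d p q).trans (hf d p q).symm))
  · rcases F with f | f
    · obtain ⟨α, x, γ, hα, hγ, hf⟩ := Families.real_point_eq f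
      refine Or.inl ⟨f, rfl, α, x, γ, hα, hγ, fun d p q => ?_⟩
      rw [Families.pairSum, map_sum, NNReal.coe_sum]
      exact Finset.sum_congr rfl fun i _ => hf _ _
    · obtain ⟨x, γ, hγ, hf⟩ := Families.tropical_point_eq f.1 f.2
      refine Or.inr ⟨f, rfl, x, γ, hγ, fun d p q => ?_⟩
      rw [Families.pairSum, map_sum, TropicalReal.val_sum]
      exact iSup_congr fun i => hf _ _
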